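/- Consider the state-dependent Gaussian multiple access channel $Y_i = X_{1,i}+X_{2,i}+S_i+Z_i$, $i=1,\dots,n$, where $S_1,S_2,\dots$ are i.i.d. $\mathcal N(0,Q)$, $Z_1,Z_2,\dots$ are i.i.d. $\mathcal N(0,1)$, the messages $M_1,M_2$ are uniform on finite sets, and messages, state and noise are independent; here $P_1,P_2,Q\ge 0$. The message sets are degraded: encoder 1 maps $(M_1,S^n)$ to $X_1^n$, encoder 2 maps $(M_1,M_2)$ to $X_2^n$, and the decoder maps $Y^n$ to $(\hat M_1,\hat M_2)$. The encoders satisfy the average power constraints $\sum_{i=1}^n \mathbb E[X_{k,i}^2]\le nP_k$, $k=1,2$. Logarithms and rates are taken to an arbitrary fixed base $b>1$. A pair $(R_1,R_2)$ of nonnegative rates is achievable if for every $n$ there is such a code of length $n$ with at least $b^{nR_1}$ messages $M_1$ and at least $b^{nR_2}$ messages $M_2$, such that $\mathbb P[(\hat M_1,\hat M_2)\ne(M_1,M_2)]\to 0$ as $n\to\infty$; the capacity region $\mathcal C_{\mathrm{deg}}(P_1,P_2,Q)$ is the closure of the set of achievable pairs. Then for every $(R_1,R_2)\in\mathcal C_{\mathrm{deg}}(P_1,P_2,Q)$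 there exist $\rho_1\in[0,1]$, $\rho_2\in[0,1]$ and $\rho_s\in[-1,0]$ with $\rho_1^2+\rho_s^2\le 1$ such that $$R_2\le \tfrac12\log\bigl(1+P_2(1-\rho_2^2)\bigr),$$ $$R_2\le \tfrac12\log\bigl(1+P_1(1-\rho_1^2-\rho_s^2)\bigr)+\tfrac12\log\Bigl(1+\frac{P_2(1-\rho_2^2)}{1+(\sqrt Q+\rho_s\sqrt{P_1})^2+P_1(1-\rho_1^2-\rho_s^2)}\Bigr),$$ $$R_1+R_2\le \tfrac12\log\bigl(1+P_1(1-\rho_1^2-\rho_s^2)\bigr)+\tfrac12\log\Bigl(1+\frac{P_2(1-\rho_2^2)+(\rho_2\sqrt{P_2}+\rho_1\sqrt{P_1})^2}{1+(\sqrt Q+\rho_s\sqrt{P_1})^2+P_1(1-\rho_1^2-\rho_s^2)}\Bigr).$$ -/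

import Mathlib

open MeasureTheory ProbabilityTheory Filter Topology
open scoped NNReal

noncomputable section

namespace DirtyMAC

/-- A block code of length `n` for the state-dependent multiple access channel
`Y = X₁ + X₂ + S + Z` with degraded message sets, with `K₁` messages `M₁` and `K₂` messages `M₂`.
Encoder 1 knows `M₁` and the whole state sequence `Sⁿ` (noncausally), encoder 2 knows `M₁` and `M₂`
but not the state, and the decoder sees `Yⁿ` only. -/
structure DegradedCode (n K₁ K₂ : ℕ) where
  enc₁ : Fin K₁ → (Fin n → ℝ) → (Fin n → ℝ)
  measurable_enc₁ : ∀ m₁, Measurable (enc₁ m₁)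
  enc₂ : Fin K₁ → Fin K₂ → (Fin n → ℝ)
  dec : (Fin n → ℝ) → Fin K₁ × Fin K₂
  measurable_dec : Measurable dec

/-- Outcomes `((M₁, M₂), (Sⁿ, Zⁿ))`: the two messages, the state sequence, the noise sequence. -/
abbrev Outcome (n K₁ K₂ : ℕ) : Type :=
  (Fin K₁ × Fin K₂) × ((Fin n → ℝ) × (Fin n → ℝ))

/-- The joint law of messages, state and noise: `(M₁, M₂)` is uniform, `Sⁿ` is i.i.d. `N(0, Q)`,
`Zⁿ` is i.i.d. `N(0, 1)`, and the three are independent. -/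
def law (n K₁ K₂ : ℕ) (Q : ℝ≥0) : Measure (Outcome n K₁ K₂) :=
  (uniformOn (Set.univ : Set (Fin K₁ × Fin K₂))).prod
    ((Measure.pi fun _ : Fin n => gaussianReal 0 Q).prod
      (Measure.pi fun _ : Fin n => gaussianReal 0 1))

namespace DegradedCode

variable {n K₁ K₂ : ℕ} (c : DegradedCode n K₁ K₂)

/-- The input sequence of the state-cognitive encoder. -/
def X₁ (ω : Outcome n K₁ K₂) : Fin n → ℝ := c.enc₁ ω.1.1 ω.2.1

/-- The input sequence of the non-cognitive encoder. -/
def X₂ (ω : Outcome n K₁ K₂) : Fin n → ℝ := c.enc₂ ω.1.1 ω.1.2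

/-- The channel output sequence `Yⁿ = X₁ⁿ + X₂ⁿ + Sⁿ + Zⁿ`. -/
def Y (ω : Outcome n K₁ K₂) : Fin n → ℝ := c.X₁ ω + c.X₂ ω + ω.2.1 + ω.2.2

/-- The average power constraints `∑ᵢ E[X₁ᵢ²] ≤ n P₁` and `∑ᵢ E[X₂ᵢ²] ≤ n P₂`
(the second moments being finite). -/
def PowerConstraint (P₁ P₂ Q : ℝ≥0) : Prop :=
  (∀ i, Integrable (fun ω => (c.X₁ ω i) ^ 2) (law n K₁ K₂ Q)) ∧
  ∑ i, ∫ ω, (c.X₁ ω i) ^ 2 ∂(law n K₁ K₂ Q) ≤ n * P₁ ∧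
  (∀ i, Integrable (fun ω => (c.X₂ ω i) ^ 2) (law n K₁ K₂ Q)) ∧
  ∑ i, ∫ ω, (c.X₂ ω i) ^ 2 ∂(law n K₁ K₂ Q) ≤ n * P₂

/-- The average probability of error `P[(M₁, M₂) ≠ (M̂₁, M̂₂)]`. -/
def errorProb (Q : ℝ≥0) : ℝ :=
  (law n K₁ K₂ Q).real {ω | c.dec (c.Y ω) ≠ ω.1}

end DegradedCode

/-- A pair of nonnegative rates `(R₁, R₂)`, measured with logarithms to base `b`, is achievable if
there are, for every block length `n`, a code with at least `b ^ (n R₁)` messages `M₁` and at least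
`b ^ (n R₂)` messages `M₂` satisfying the power constraints, such that the average probability of
error tends to `0`. -/
def Achievable (b : ℝ) (P₁ P₂ Q : ℝ≥0) (R : ℝ × ℝ) : Prop :=
  0 ≤ R.1 ∧ 0 ≤ R.2 ∧
  ∃ (K₁ K₂ : ℕ → ℕ) (c : ∀ n, DegradedCode n (K₁ n) (K₂ n)),
    (∀ n : ℕ, b ^ ((n : ℝ) * R.1) ≤ (K₁ n : ℝ)) ∧
    (∀ n : ℕ, b ^ ((n : ℝ) * R.2) ≤ (K₂ n : ℝ)) ∧
    (∀ n, (c n).PowerConstraint P₁ P₂ Q) ∧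
    Tendsto (fun n => (c n).errorProb Q) atTop (𝓝 0)

/-- The capacity region with degraded message sets: the closure of the set of achievable pairs. -/
def capacityRegionDeg (b : ℝ) (P₁ P₂ Q : ℝ≥0) : Set (ℝ × ℝ) :=
  closure {R | Achievable b P₁ P₂ Q R}

end DirtyMAC

end

/-! ### Gaussian log-densities and the change-of-measure inequality. -/

noncomputable section

namespace DirtyMAC

open scoped ENNReal

/-! The converse is a change of measure. The true law of messages, state and output is compared with
reference laws (of mass at most one) under which decoding succeeds with probability at most `J / (K₁
* K₂)`. By the Fano-type bound `integral_add_measureReal_mul_log_le`, the relative entropy then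
controls `log (K₁ * K₂ / J)`, up to the success probability as a factor and an additive `log 2`. All
references are built from Gaussian densities, so their log-densities are quadratic and the relative
entropy is an explicit function of second moments; no differential entropy of the output is ever
needed.

One reference reveals the state to the decoder (`log_card₂_le_of_state`). The others
(`log_card_le_of_mean`) mirror the identity I(M;Y) = I(M,S;Y) − I(S;Y|M): the output is Gaussian,
and the state given messages and output is Gaussian around its linear estimate. Integrating the
state out leaves an output law that ignores `M₂`, or both messages, while the estimate improves the
bound by the ratio of its error variance to `Q`.

The moments, averaged over messages and time, are the single-letter parameters. Cauchy–Schwarz and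
the power constraints turn them into correlations (`exists_corrParams`), and the monotonicity
`gain_mono` absorbs unused power and the sign of the state correlation. Since the correlations range
over a compact set, the outer region is closed, which settles both the limit in `n` and the closure
defining capacity. -/

/-- The logarithm of the density of the Gaussian law on `ℝⁿ` with mean `μ` and covariance `v • 1`.
It vanishes for `v = 0`. -/
def logGauss {n : ℕ} (v : ℝ) (μ y : Fin n → ℝ) : ℝ :=
  -(∑ i, (y i - μ i) ^ 2) / (2 * v) - n / 2 * Real.log (2 * Real.pi * v)

/-- The law of `n` i.i.d. centred Gaussians of variance `v`. -/
abbrev gaussPi (n : ℕ) (v : ℝ≥0) : Measure (Fin n → ℝ) :=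
  Measure.pi fun _ : Fin n => gaussianReal 0 v

@[fun_prop]
lemma measurable_logGauss_comp {α : Type*} [MeasurableSpace α] {n : ℕ} (v : ℝ)
    {f g : α → Fin n → ℝ} (hf : Measurable f) (hg : Measurable g) :
    Measurable fun a => logGauss v (f a) (g a) := by
  unfold logGauss
  have h : ∀ i, Measurable fun a => (g a i - f a i) ^ 2 := fun i => by fun_prop
  exact (((Finset.measurable_sum _ fun i _ => h i).neg).div_const _).sub_const _

lemma exp_logGauss_eq_prod {n : ℕ} {v : ℝ≥0} (hv : v ≠ 0) (μ y : Fin n → ℝ) :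
    Real.exp (logGauss v μ y) = ∏ i, gaussianPDFReal (μ i) v (y i) := by
  have hv' : (0 : ℝ) < v := by positivity
  have hp : (0 : ℝ) < 2 * Real.pi * v := by positivity
  have h1 : (√(2 * Real.pi * v))⁻¹ = Real.exp (-(1 / 2 * Real.log (2 * Real.pi * v))) := by
    rw [Real.exp_neg, one_div, inv_mul_eq_div, ← Real.log_sqrt hp.le,
      Real.exp_log (Real.sqrt_pos.2 hp)]
  simp only [gaussianPDFReal, h1, ← Real.exp_add, ← Real.exp_sum]
  congr 1
  rw [Finset.sum_add_distrib, ← Finset.sum_div, Finset.sum_neg_distrib]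
  simp [logGauss]
  ring

lemma gaussPi_eq_withDensity (n : ℕ) {v : ℝ≥0} (hv : v ≠ 0) :
    gaussPi n v = volume.withDensity fun y => ENNReal.ofReal (Real.exp (logGauss v 0 y)) := by
  refine (Measure.pi_eq fun s hs => ?_)
  rw [withDensity_apply _ (MeasurableSet.univ_pi hs)]
  have hint : ∀ i, Integrable ((s i).indicator (gaussianPDFReal 0 v)) := fun i =>
    (integrable_gaussianPDFReal 0 v).indicator (hs i)
  have hnn : ∀ i x, 0 ≤ (s i).indicator (gaussianPDFReal 0 v) x := fun i x =>
    Set.indicator_nonneg (fun x _ => gaussianPDFReal_nonneg 0 v x) x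
  have hind : ∀ y : Fin n → ℝ, (Set.univ.pi s).indicator
      (fun y => ENNReal.ofReal (Real.exp (logGauss v 0 y))) y
      = ENNReal.ofReal (∏ i, (s i).indicator (gaussianPDFReal 0 v) (y i)) := by
    intro y
    by_cases hy : y ∈ Set.univ.pi s
    · rw [Set.indicator_of_mem hy, exp_logGauss_eq_prod hv]
      congr 1
      refine Finset.prod_congr rfl fun i _ => ?_
      rw [Set.indicator_of_mem (hy i trivial)]
      rfl
    · rw [Set.indicator_of_notMem hy]
      simp only [Set.mem_pi, Set.mem_univ, true_imp_iff, not_forall] at hy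
      obtain ⟨i, hi⟩ := hy
      rw [Finset.prod_eq_zero (Finset.mem_univ i) (Set.indicator_of_notMem hi _)]
      simp
  rw [← lintegral_indicator (MeasurableSet.univ_pi hs)]
  simp_rw [hind]
  have hprod : Integrable (fun y : Fin n → ℝ =>
      ∏ i, (s i).indicator (gaussianPDFReal 0 v) (y i)) :=
    Integrable.fintype_prod (μ := fun _ => volume) hint
  rw [← ofReal_integral_eq_lintegral_ofReal hprod
    (ae_of_all _ fun y => Finset.prod_nonneg fun i _ => hnn i _)]
  rw [integral_fintype_prod_volume_eq_prod (fun i => (s i).indicator (gaussianPDFReal 0 v)),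
    ENNReal.ofReal_prod_of_nonneg fun i _ => integral_nonneg (hnn i)]
  refine Finset.prod_congr rfl fun i _ => ?_
  rw [integral_indicator (hs i), gaussianReal_apply_eq_integral _ hv]

lemma lintegral_gaussPi (n : ℕ) {v : ℝ≥0} (hv : v ≠ 0) {f : (Fin n → ℝ) → ℝ≥0∞}
    (hf : Measurable f) :
    ∫⁻ y, f y ∂gaussPi n v = ∫⁻ y, ENNReal.ofReal (Real.exp (logGauss v 0 y)) * f y := by
  rw [gaussPi_eq_withDensity n hv, lintegral_withDensity_eq_lintegral_mul _ (by fun_prop) hf]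
  rfl

lemma lintegral_exp_logGauss {n : ℕ} {v : ℝ} (hv : 0 < v) (μ : Fin n → ℝ) :
    ∫⁻ y, ENNReal.ofReal (Real.exp (logGauss v μ y)) = 1 := by
  lift v to ℝ≥0 using hv.le
  have hv' : v ≠ 0 := by rintro rfl; simp at hv
  have h := lintegral_gaussPi n hv' (f := fun _ => 1) measurable_const
  simp only [lintegral_one, measure_univ, mul_one] at h
  rw [h, ← lintegral_sub_right_eq_self (fun y => ENNReal.ofReal (Real.exp (logGauss v 0 y))) μ]
  simp [logGauss]

/-- The Radon–Nikodym factor of the law of mean `μ` and variance `θ` with respect to the centred one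
of variance `Q` has total mass at most one; for `Q = θ = 0` the factor is `1`. -/
lemma lintegral_exp_logGauss_sub {n : ℕ} {Q : ℝ≥0} {θ : ℝ} (hθ : Q ≠ 0 → 0 < θ)
    (hθ0 : Q = 0 → θ = 0) (μ : Fin n → ℝ) :
    ∫⁻ s, ENNReal.ofReal (Real.exp (logGauss θ μ s - logGauss Q 0 s)) ∂gaussPi n Q ≤ 1 := by
  by_cases hQ : Q = 0
  · simp [logGauss, hQ, hθ0 hQ]
  · rw [lintegral_gaussPi n hQ (by fun_prop), ← lintegral_exp_logGauss (hθ hQ) μ]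
    refine (lintegral_congr fun y => ?_).le
    rw [← ENNReal.ofReal_mul (Real.exp_pos _).le, ← Real.exp_add]
    congr 2; ring

/-- Dividing by the noise density turns the Gaussian law of `z` into Lebesgue measure, which is
invariant under the shift by the noiseless signal `t`. Thus a density in the output variable can be
integrated against the noise. -/
lemma setLIntegral_noise_shift {n : ℕ} (t : Fin n → ℝ) {f : (Fin n → ℝ) → ℝ} (hf : Measurable f)
    {B : Set (Fin n → ℝ)} (hB : MeasurableSet B) :
    ∫⁻ z in {z | t + z ∈ B}, ENNReal.ofReal (Real.exp (f (t + z) - logGauss 1 0 z)) ∂gaussPi n 1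
      = ∫⁻ y in B, ENNReal.ofReal (Real.exp (f y)) := by
  have hB' : MeasurableSet {z | t + z ∈ B} := (measurable_const_add t) hB
  rw [← lintegral_indicator hB', lintegral_gaussPi n one_ne_zero
    (Measurable.indicator (by fun_prop) hB'), ← lintegral_indicator hB,
    ← lintegral_add_left_eq_self (B.indicator fun y => ENNReal.ofReal (Real.exp (f y))) t]
  refine lintegral_congr fun z => ?_
  by_cases hz : t + z ∈ B
  · rw [Set.indicator_of_mem (s := {z | t + z ∈ B}) hz, Set.indicator_of_mem hz,
      ← ENNReal.ofReal_mul (Real.exp_pos _).le, ← Real.exp_add, NNReal.coe_one, add_sub_cancel]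
  · rw [Set.indicator_of_notMem (s := {z | t + z ∈ B}) hz, Set.indicator_of_notMem hz, mul_zero]

/-- A change-of-measure form of Fano's inequality. -/
lemma integral_add_measureReal_mul_log_le {Ω : Type*} [MeasurableSpace Ω] (P : Measure Ω)
    [IsProbabilityMeasure P] {L : Ω → ℝ} (hL : Integrable L P) {A : Set Ω} (hA : MeasurableSet A)
    {K : ℝ} (hK : 0 < K)
    (hAK : ∫⁻ ω in A, ENNReal.ofReal (Real.exp (L ω)) ∂P ≤ ENNReal.ofReal (1 / K))
    (hU : ∫⁻ ω, ENNReal.ofReal (Real.exp (L ω)) ∂P ≤ 1) :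
    ∫ ω, L ω ∂P + P.real A * Real.log K ≤ Real.log 2 := by
  have hLm : AEStronglyMeasurable (fun ω => Real.exp (L ω)) P :=
    Real.continuous_exp.comp_aestronglyMeasurable hL.aestronglyMeasurable
  have hexp : Integrable (fun ω => Real.exp (L ω)) P := by
    refine ⟨hLm, ?_⟩
    rw [hasFiniteIntegral_iff_ofReal (ae_of_all _ fun ω => (Real.exp_pos _).le)]
    exact hU.trans_lt ENNReal.one_lt_top
  have hU' : ∫ ω, Real.exp (L ω) ∂P ≤ 1 := by
    rw [integral_eq_lintegral_of_nonneg_ae (ae_of_all _ fun ω => (Real.exp_pos _).le) hLm]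
    exact ENNReal.toReal_le_of_le_ofReal zero_le_one (by simpa using hU)
  have hA' : ∫ ω in A, Real.exp (L ω) ∂P ≤ 1 / K := by
    rw [integral_eq_lintegral_of_nonneg_ae (ae_of_all _ fun ω => (Real.exp_pos _).le)
      hLm.restrict]
    exact ENNReal.toReal_le_of_le_ofReal (by positivity) hAK
  -- This is `log x ≤ x - 1` at the mixture `exp L * (K * 1_A + 1) / 2`, slightly weakened; the
  -- mixture has mass at most one, because each of its halves contributes at most 1/2.
  have hpt : ∀ ω, L ω + A.indicator (fun _ => Real.log K) ω - Real.log 2 ≤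
      K / 2 * A.indicator (fun ω => Real.exp (L ω)) ω + 1 / 2 * Real.exp (L ω) - 1 := by
    intro ω
    by_cases hω : ω ∈ A
    · simp only [Set.indicator_of_mem hω]
      have h := Real.log_le_sub_one_of_pos (x := Real.exp (L ω) * K / 2) (by positivity)
      rw [Real.log_div (by positivity) two_ne_zero, Real.log_mul (by positivity) hK.ne',
        Real.log_exp] at h
      nlinarith [Real.exp_pos (L ω)]
    · simp only [Set.indicator_of_notMem hω]
      have h := Real.log_le_sub_one_of_pos (x := Real.exp (L ω) / 2) (by positivity)
      rw [Real.log_div (by positivity) two_ne_zero, Real.log_exp] at h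
      linarith
  have hc : Integrable (A.indicator fun _ => Real.log K) P :=
    (integrable_const _).indicator hA
  have hi : Integrable (A.indicator fun ω => Real.exp (L ω)) P := hexp.indicator hA
  have hl : ∫ ω, (L ω + A.indicator (fun _ => Real.log K) ω - Real.log 2) ∂P
      = ∫ ω, L ω ∂P + P.real A * Real.log K - Real.log 2 := by
    rw [integral_sub (by exact hL.add hc) (integrable_const _), integral_add hL hc,
      integral_indicator hA]
    simp
  have hr : ∫ ω, (K / 2 * A.indicator (fun ω => Real.exp (L ω)) ω + 1 / 2 * Real.exp (L ω) - 1) ∂P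
      = K / 2 * ∫ ω in A, Real.exp (L ω) ∂P + 1 / 2 * ∫ ω, Real.exp (L ω) ∂P - 1 := by
    rw [integral_sub (by exact (hi.const_mul (K / 2)).add (hexp.const_mul (1 / 2)))
      (integrable_const _), integral_add (hi.const_mul _) (hexp.const_mul _),
      integral_const_mul, integral_const_mul, integral_indicator hA]
    simp
  have h := integral_mono (by exact (hL.add hc).sub (integrable_const (Real.log 2)))
    (by exact ((hi.const_mul (K / 2)).add (hexp.const_mul (1 / 2))).sub (integrable_const 1)) hpt
  rw [hl, hr] at h
  have h2 : K / 2 * ∫ ω in A, Real.exp (L ω) ∂P ≤ 1 / 2 := by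
    calc _ ≤ K / 2 * (1 / K) := by gcongr
      _ = 1 / 2 := by field_simp
  linarith

end DirtyMAC

/-! ### Integration and second moments under the joint law. -/

namespace DirtyMAC

open scoped ENNReal

lemma memLp_coord (n : ℕ) (v : ℝ≥0) (i : Fin n) :
    MemLp (fun z : Fin n → ℝ => z i) 2 (gaussPi n v) :=
  (memLp_id_gaussianReal' (μ := 0) (v := v) 2 (by simp)).comp_measurePreserving
    (measurePreserving_eval (fun _ : Fin n => gaussianReal 0 v) i)

lemma integral_coord (n : ℕ) (v : ℝ≥0) (i : Fin n) :
    ∫ z : Fin n → ℝ, z i ∂gaussPi n v = 0 := by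
  rw [integral_comp_eval (μ := fun _ : Fin n => gaussianReal 0 v) (f := fun x : ℝ => x)
    (by fun_prop), integral_id_gaussianReal]

lemma integral_coord_sq (n : ℕ) (v : ℝ≥0) (i : Fin n) :
    ∫ z : Fin n → ℝ, z i ^ 2 ∂gaussPi n v = v := by
  rw [integral_comp_eval (μ := fun _ : Fin n => gaussianReal 0 v) (f := fun x : ℝ => x ^ 2)
    (by fun_prop)]
  have h := variance_fun_id_gaussianReal (μ := 0) (v := v)
  rwa [variance_of_integral_eq_zero (by fun_prop) integral_id_gaussianReal] at h

lemma integral_sq_add_const_mul {α β : Type*} [MeasurableSpace α] [MeasurableSpace β]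
    (μ : Measure α) (ν : Measure β) [IsProbabilityMeasure μ] [IsProbabilityMeasure ν]
    {f : α → ℝ} {g : β → ℝ} (hf : MemLp f 2 μ) (hg : MemLp g 2 ν) (hg0 : ∫ y, g y ∂ν = 0) (a : ℝ) :
    Integrable (fun p : α × β => (f p.1 + a * g p.2) ^ 2) (μ.prod ν) ∧
    ∫ p, (f p.1 + a * g p.2) ^ 2 ∂μ.prod ν = ∫ x, f x ^ 2 ∂μ + a ^ 2 * ∫ y, g y ^ 2 ∂ν := by
  have hf2 := hf.comp_fst ν
  have hg2 := hg.comp_snd μ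
  refine ⟨(hf2.add (hg2.const_mul a)).integrable_sq, ?_⟩
  have e : (fun p : α × β => (f p.1 + a * g p.2) ^ 2) = fun p =>
      f p.1 ^ 2 + 2 * a * (f p.1 * g p.2) + a ^ 2 * g p.2 ^ 2 := by
    funext p; ring
  have i1 : Integrable (fun p : α × β => f p.1 ^ 2) (μ.prod ν) := hf2.integrable_sq
  have i2 : Integrable (fun p : α × β => f p.1 * g p.2) (μ.prod ν) := hf2.integrable_mul hg2
  have i3 : Integrable (fun p : α × β => g p.2 ^ 2) (μ.prod ν) := hg2.integrable_sq
  rw [e, integral_add (by exact i1.add (i2.const_mul _)) (i3.const_mul _),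
    integral_add i1 (i2.const_mul _), integral_const_mul, integral_const_mul,
    integral_prod_mul, hg0, integral_fun_fst (fun x => f x ^ 2),
    integral_fun_snd (fun y => g y ^ 2)]
  simp

section Law

variable {n K₁ K₂ : ℕ} {Q : ℝ≥0}

lemma law_eq (n K₁ K₂ : ℕ) (Q : ℝ≥0) :
    law n K₁ K₂ Q = ((K₁ : ℝ≥0∞) * K₂)⁻¹ •
      (Measure.count.prod ((gaussPi n Q).prod (gaussPi n 1))) := by
  rw [law, uniformOn, ProbabilityTheory.cond, Measure.restrict_univ, Measure.prod_smul_left]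
  simp [Measure.count_apply_finite]

lemma isProbabilityMeasure_law (h₁ : 0 < K₁) (h₂ : 0 < K₂) :
    IsProbabilityMeasure (law n K₁ K₂ Q) := by
  have : Nonempty (Fin K₁ × Fin K₂) := ⟨(⟨0, h₁⟩, ⟨0, h₂⟩)⟩
  have := isProbabilityMeasure_uniformOn (Set.finite_univ (α := Fin K₁ × Fin K₂))
    Set.univ_nonempty
  unfold law
  infer_instance

lemma lintegral_law {F : Outcome n K₁ K₂ → ℝ≥0∞} (hF : Measurable F) :
    ∫⁻ ω, F ω ∂law n K₁ K₂ Q = ((K₁ : ℝ≥0∞) * K₂)⁻¹ *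
      ∑ m, ∫⁻ s, ∫⁻ z, F (m, (s, z)) ∂gaussPi n 1 ∂gaussPi n Q := by
  rw [law_eq, lintegral_smul_measure, lintegral_prod _ hF.aemeasurable, lintegral_count,
    tsum_fintype, smul_eq_mul]
  congr 1
  refine Finset.sum_congr rfl fun m _ => ?_
  rw [lintegral_prod _ (by fun_prop)]

lemma integrable_law_of_forall {F : Outcome n K₁ K₂ → ℝ} (h₁ : 0 < K₁) (h₂ : 0 < K₂)
    (hF : ∀ m, Measurable fun p => F (m, p))
    (hi : ∀ m, Integrable (fun p => F (m, p)) ((gaussPi n Q).prod (gaussPi n 1))) :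
    Integrable F (law n K₁ K₂ Q) ∧ ∫ ω, F ω ∂law n K₁ K₂ Q = ((K₁ : ℝ) * K₂)⁻¹ *
      ∑ m, ∫ p, F (m, p) ∂(gaussPi n Q).prod (gaussPi n 1) := by
  have hFm : Measurable F := measurable_from_prod_countable_right hF
  have hint : Integrable F (Measure.count.prod ((gaussPi n Q).prod (gaussPi n 1))) := by
    rw [integrable_prod_iff hFm.aestronglyMeasurable]
    exact ⟨ae_of_all _ hi, .of_finite⟩
  constructor
  · rw [law_eq]
    refine hint.smul_measure ?_
    simp [h₁.ne', h₂.ne']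
  · rw [law_eq, integral_smul_measure, integral_prod _ hint, integral_count]
    simp

/-- Every message pair carries positive mass, so a property holding for almost every pair holds for
all of them. -/
lemma integrable_of_integrable_law {F : Outcome n K₁ K₂ → ℝ} (h₁ : 0 < K₁) (h₂ : 0 < K₂)
    (hi : Integrable F (law n K₁ K₂ Q)) (m : Fin K₁ × Fin K₂) :
    Integrable (fun p => F (m, p)) ((gaussPi n Q).prod (gaussPi n 1)) := by
  rw [law_eq, integrable_smul_measure (by simp [ENNReal.mul_eq_top])
    (by simp [h₁.ne', h₂.ne'])] at hi
  have h := hi.prod_right_ae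
  rw [Measure.ae_count_iff] at h
  exact h m

/-- Second moments of `F(M, S) + a Z` under the joint law. -/
lemma integral_law_sum_sq (h₁ : 0 < K₁) (h₂ : 0 < K₂)
    {F : Fin K₁ × Fin K₂ → (Fin n → ℝ) → Fin n → ℝ} (hF : ∀ m, Measurable (F m))
    (hF2 : ∀ m i, MemLp (fun s => F m s i) 2 (gaussPi n Q)) (a : ℝ) :
    Integrable (fun ω : Outcome n K₁ K₂ => ∑ i, (F ω.1 ω.2.1 i + a * ω.2.2 i) ^ 2)
      (law n K₁ K₂ Q) ∧
    ∫ ω, ∑ i, (F ω.1 ω.2.1 i + a * ω.2.2 i) ^ 2 ∂law n K₁ K₂ Q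
      = ((K₁ : ℝ) * K₂)⁻¹ * ∑ m, ∑ i, (∫ s, F m s i ^ 2 ∂gaussPi n Q + a ^ 2) := by
  have key := fun m i => integral_sq_add_const_mul (gaussPi n Q) (gaussPi n 1) (hF2 m i)
    (memLp_coord n 1 i) (integral_coord n 1 i) a
  have hm : ∀ m i, Measurable fun s => F m s i := fun m i => (measurable_pi_apply i).comp (hF m)
  obtain ⟨hI, hE⟩ := integrable_law_of_forall (n := n) (Q := Q) h₁ h₂
    (F := fun ω => ∑ i, (F ω.1 ω.2.1 i + a * ω.2.2 i) ^ 2)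
    (fun m => by
      refine Finset.measurable_sum _ fun i _ => ?_
      have h : Measurable fun p : (Fin n → ℝ) × (Fin n → ℝ) => F m p.1 i :=
        (hm m i).comp measurable_fst
      exact (h.add (by fun_prop)).pow_const 2)
    (fun m => integrable_finsetSum _ fun i _ => (key m i).1)
  refine ⟨hI, hE.trans ?_⟩
  congr 1
  refine Finset.sum_congr rfl fun m _ => ?_
  rw [integral_finsetSum _ fun i _ => (key m i).1]
  refine Finset.sum_congr rfl fun i _ => ?_
  rw [(key m i).2, integral_coord_sq]
  simp

end Law

end DirtyMAC

/-! ### Comparison of a code with a reference law. -/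

namespace DirtyMAC

open scoped ENNReal

variable {n K₁ K₂ : ℕ} {Q : ℝ≥0}

namespace DegradedCode

variable (c : DegradedCode n K₁ K₂)

/-- The noiseless output `X₁ⁿ + X₂ⁿ + Sⁿ` as a function of messages and state. -/
def signal (m : Fin K₁ × Fin K₂) (s : Fin n → ℝ) : Fin n → ℝ :=
  c.enc₁ m.1 s + c.enc₂ m.1 m.2 + s

lemma measurable_signal (m : Fin K₁ × Fin K₂) : Measurable (c.signal m) :=
  ((c.measurable_enc₁ m.1).add_const _).add measurable_id

lemma measurable_Y : Measurable c.Y := by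
  refine measurable_from_prod_countable_right fun m => ?_
  exact ((c.measurable_signal m).comp measurable_fst).add measurable_snd

lemma measurable_Y_apply (m : Fin K₁ × Fin K₂) :
    Measurable fun p : (Fin n → ℝ) × (Fin n → ℝ) => c.Y (m, p) :=
  ((c.measurable_signal m).comp measurable_fst).add measurable_snd

lemma measurableSet_dec (m : Fin K₁ × Fin K₂) : MeasurableSet (c.dec ⁻¹' {m}) :=
  c.measurable_dec (measurableSet_singleton m)

lemma measurableSet_success : MeasurableSet {ω : Outcome n K₁ K₂ | c.dec (c.Y ω) = ω.1} :=
  measurableSet_eq_fun (c.measurable_dec.comp c.measurable_Y) measurable_fst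

/-- Comparison of the joint law of messages, state and output with a reference law under which
decoding succeeds with probability at most `J / (K₁ K₂)`. The reference law has log-density `W m`
with respect to the product of the state law and Lebesgue measure. -/
theorem log_card_le_of_reference (h₁ : 0 < K₁) (h₂ : 0 < K₂)
    {W : Fin K₁ × Fin K₂ → (Fin n → ℝ) → (Fin n → ℝ) → ℝ}
    (hW : ∀ m, Measurable fun p : (Fin n → ℝ) × (Fin n → ℝ) => W m p.1 p.2)
    (hL : Integrable (fun ω : Outcome n K₁ K₂ => W ω.1 ω.2.1 (c.Y ω) - logGauss 1 0 ω.2.2)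
      (law n K₁ K₂ Q))
    (hU : ∀ m, ∫⁻ s, ∫⁻ y, ENNReal.ofReal (Real.exp (W m s y)) ∂volume ∂gaussPi n Q ≤ 1)
    {J : ℕ} (hJ : 0 < J)
    (hA : ∑ m, ∫⁻ s, ∫⁻ y in c.dec ⁻¹' {m}, ENNReal.ofReal (Real.exp (W m s y)) ∂volume ∂gaussPi n Q
      ≤ J) :
    ∫ ω, (W ω.1 ω.2.1 (c.Y ω) - logGauss 1 0 ω.2.2) ∂law n K₁ K₂ Q
      + (1 - c.errorProb Q) * Real.log (K₁ * K₂ / J) ≤ Real.log 2 := by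
  have := isProbabilityMeasure_law (n := n) (Q := Q) h₁ h₂
  have hk₁ : (0 : ℝ) < K₁ := by exact_mod_cast h₁
  have hk₂ : (0 : ℝ) < K₂ := by exact_mod_cast h₂
  have hj : (0 : ℝ) < J := by exact_mod_cast hJ
  set A := {ω : Outcome n K₁ K₂ | c.dec (c.Y ω) = ω.1}
  have hAm : MeasurableSet A := c.measurableSet_success
  have hprob : 1 - c.errorProb Q = (law n K₁ K₂ Q).real A := by
    have : {ω : Outcome n K₁ K₂ | c.dec (c.Y ω) ≠ ω.1} = Aᶜ := rfl
    rw [errorProb, this, probReal_compl_eq_one_sub hAm, sub_sub_cancel]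
  have hLm : Measurable fun ω : Outcome n K₁ K₂ =>
      W ω.1 ω.2.1 (c.Y ω) - logGauss 1 0 ω.2.2 := by
    refine measurable_from_prod_countable_right fun m => ?_
    exact ((hW m).comp (measurable_fst.prodMk (c.measurable_Y_apply m))).sub
      (measurable_logGauss_comp 1 measurable_const measurable_snd)
  have hLe : Measurable fun ω : Outcome n K₁ K₂ =>
      ENNReal.ofReal (Real.exp (W ω.1 ω.2.1 (c.Y ω) - logGauss 1 0 ω.2.2)) :=
    hLm.exp.ennreal_ofReal
  -- Given `m` and `s`, the output is the signal plus noise, so subtracting the noise log-density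
  -- from `W` gives the log-likelihood ratio of the reference law to the true one.
  have hshift : ∀ (m : Fin K₁ × Fin K₂) (s : Fin n → ℝ) {B : Set (Fin n → ℝ)},
      MeasurableSet B →
      ∫⁻ z in {z | c.signal m s + z ∈ B},
        ENNReal.ofReal (Real.exp (W m s (c.Y (m, (s, z))) - logGauss 1 0 z)) ∂gaussPi n 1
      = ∫⁻ y in B, ENNReal.ofReal (Real.exp (W m s y)) := fun m s B hB =>
    setLIntegral_noise_shift (c.signal m s) ((hW m).comp measurable_prodMk_left) hB
  rw [hprob]
  refine integral_add_measureReal_mul_log_le _ hL hAm (by positivity) ?_ ?_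
  · rw [← lintegral_indicator hAm, lintegral_law (hLe.indicator hAm)]
    have hsum : ∑ m, ∫⁻ s, ∫⁻ z, A.indicator (fun ω => ENNReal.ofReal
        (Real.exp (W ω.1 ω.2.1 (c.Y ω) - logGauss 1 0 ω.2.2))) (m, (s, z))
          ∂gaussPi n 1 ∂gaussPi n Q ≤ J := by
      refine le_trans (Finset.sum_le_sum fun m _ => lintegral_mono fun s => ?_) hA
      have hB : MeasurableSet {z | c.signal m s + z ∈ c.dec ⁻¹' {m}} :=
        (measurable_const_add (c.signal m s)) (c.measurableSet_dec m)
      rw [← hshift m s (c.measurableSet_dec m), ← lintegral_indicator hB]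
      exact le_of_eq rfl
    calc _ ≤ ((K₁ : ℝ≥0∞) * K₂)⁻¹ * J := by gcongr
      _ = ENNReal.ofReal (1 / (K₁ * K₂ / J)) := by
        rw [one_div, inv_div, ENNReal.ofReal_div_of_pos (by positivity),
          ENNReal.ofReal_mul hk₁.le]
        simp [ENNReal.div_eq_inv_mul]
  · rw [lintegral_law hLe]
    have hone : ∀ m, ∫⁻ s, ∫⁻ z, ENNReal.ofReal
        (Real.exp (W m s (c.Y (m, (s, z))) - logGauss 1 0 z)) ∂gaussPi n 1 ∂gaussPi n Q ≤ 1 := by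
      intro m
      refine le_trans (lintegral_mono fun s => ?_) (hU m)
      have := hshift m s MeasurableSet.univ
      simp only [Set.mem_univ, Set.ofPred_true, Measure.restrict_univ] at this
      exact this.le
    calc _ ≤ ((K₁ : ℝ≥0∞) * K₂)⁻¹ * ∑ m : Fin K₁ × Fin K₂, 1 := by
          gcongr with m; exact hone m
      _ = 1 := by
        simp only [Finset.sum_const, Finset.card_univ, Fintype.card_prod, Fintype.card_fin,
          nsmul_eq_mul, mul_one, Nat.cast_mul]
        exact ENNReal.inv_mul_cancel (by simp [h₁.ne', h₂.ne']) (by simp [ENNReal.mul_eq_top])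

/-- The decoding regions of distinct message pairs are disjoint: an output law that ignores the
messages decodes correctly with total weight at most its mass. -/
lemma sum_setLIntegral_dec_le {f : (Fin n → ℝ) → ℝ≥0∞} (T : Finset (Fin K₁ × Fin K₂)) :
    ∑ m ∈ T, ∫⁻ y in c.dec ⁻¹' {m}, f y ≤ ∫⁻ y, f y := by
  rw [← lintegral_biUnion_finset]
  · exact setLIntegral_le_lintegral _ _
  · intro m _ m' _ hne
    exact Set.disjoint_left.2 fun y hy hy' => hne (hy.symm.trans hy')
  · exact fun m _ => c.measurableSet_dec m

/-- Disjointness is applied separately for each `m₁`, so an output law that may depend on `m₁` costs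
a factor `K₁`. -/
lemma sum_setLIntegral_dec_le' {f : Fin K₁ → (Fin n → ℝ) → ℝ≥0∞} (hf : ∀ m₁, ∫⁻ y, f m₁ y ≤ 1) :
    ∑ m : Fin K₁ × Fin K₂, ∫⁻ y in c.dec ⁻¹' {m}, f m.1 y ≤ K₁ := by
  rw [Fintype.sum_prod_type]
  calc _ ≤ ∑ _m₁ : Fin K₁, (1 : ℝ≥0∞) := Finset.sum_le_sum fun m₁ _ => by
        refine le_trans ?_ (hf m₁)
        have h := c.sum_setLIntegral_dec_le (f := f m₁)
          (Finset.univ.map ⟨fun m₂ : Fin K₂ => (m₁, m₂), Prod.mk_right_injective m₁⟩)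
        rwa [Finset.sum_map] at h
    _ = K₁ := by simp

/-- By Tonelli the state is integrated first. Its conditional factor has mass at most one for every
output, so only the output density `φ` is left to be tested by the decoder. -/
lemma lintegral_reference_le {φ : (Fin n → ℝ) → ℝ} {ψ : (Fin n → ℝ) → (Fin n → ℝ) → ℝ}
    (hφ : Measurable φ) (hψ : Measurable fun p : (Fin n → ℝ) × (Fin n → ℝ) => ψ p.1 p.2)
    (hψ1 : ∀ y, ∫⁻ s, ENNReal.ofReal (Real.exp (ψ s y)) ∂gaussPi n Q ≤ 1) (B : Set (Fin n → ℝ)) :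
    ∫⁻ s, ∫⁻ y in B, ENNReal.ofReal (Real.exp (φ y + ψ s y)) ∂volume ∂gaussPi n Q
      ≤ ∫⁻ y in B, ENNReal.ofReal (Real.exp (φ y)) := by
  rw [lintegral_lintegral_swap]
  · apply lintegral_mono
    intro y
    simp only [Real.exp_add, ENNReal.ofReal_mul (Real.exp_pos _).le]
    have h : Measurable fun s => ENNReal.ofReal (Real.exp (ψ s y)) :=
      ENNReal.measurable_ofReal.comp (Real.measurable_exp.comp (hψ.comp measurable_prodMk_right))
    rw [lintegral_const_mul _ h]
    exact mul_le_of_le_one_right' (hψ1 y)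
  · exact (ENNReal.measurable_ofReal.comp (Real.measurable_exp.comp
      ((hφ.comp measurable_snd).add hψ))).aemeasurable

end DegradedCode

end DirtyMAC

/-! ### Averaged moments of a code. -/

namespace DirtyMAC

open scoped ENNReal

variable {n K₁ K₂ : ℕ} {Q : ℝ≥0}

/-- The average over all message pairs and all time instants. -/
def avg (F : Fin K₁ × Fin K₂ → Fin n → ℝ) : ℝ :=
  ((K₁ : ℝ) * K₂)⁻¹ * (n : ℝ)⁻¹ * ∑ m, ∑ i, F m i

lemma avg_add (F G : Fin K₁ × Fin K₂ → Fin n → ℝ) :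
    avg (fun m i => F m i + G m i) = avg F + avg G := by
  simp only [avg, Finset.sum_add_distrib, mul_add]

lemma avg_const_mul (a : ℝ) (F : Fin K₁ × Fin K₂ → Fin n → ℝ) :
    avg (fun m i => a * F m i) = a * avg F := by
  simp only [avg, ← Finset.mul_sum]; ring

lemma avg_const (hn : 0 < n) (h₁ : 0 < K₁) (h₂ : 0 < K₂) (a : ℝ) :
    avg (fun (_ : Fin K₁ × Fin K₂) (_ : Fin n) => a) = a := by
  simp [avg]
  field_simp

lemma avg_nonneg {F : Fin K₁ × Fin K₂ → Fin n → ℝ} (hF : ∀ m i, 0 ≤ F m i) : 0 ≤ avg F := by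
  unfold avg
  have : 0 ≤ ∑ m, ∑ i, F m i := Finset.sum_nonneg fun m _ => Finset.sum_nonneg fun i _ => hF m i
  positivity

lemma mul_avg (hn : 0 < n) (F : Fin K₁ × Fin K₂ → Fin n → ℝ) :
    n * avg F = ((K₁ : ℝ) * K₂)⁻¹ * ∑ m, ∑ i, F m i := by
  unfold avg; field_simp

lemma sq_le_mul_of_forall_quadratic_nonneg {a b k : ℝ} (h : ∀ t : ℝ, 0 ≤ a + 2 * t * k + t ^ 2 * b) :
    k ^ 2 ≤ a * b := by
  have := discrim_le_zero (a := b) (b := 2 * k) (c := a) fun t => by linarith [h t]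
  rw [discrim] at this
  linarith

lemma avg_mul_sq_le (F G : Fin K₁ × Fin K₂ → Fin n → ℝ) :
    avg (fun m i => F m i * G m i) ^ 2 ≤ avg (fun m i => F m i ^ 2) * avg (fun m i => G m i ^ 2) := by
  refine sq_le_mul_of_forall_quadratic_nonneg fun t => ?_
  rw [← avg_const_mul, ← avg_const_mul, ← avg_add, ← avg_add]
  refine avg_nonneg fun m i => ?_
  nlinarith [sq_nonneg (F m i + t * G m i)]

/-- Second moment of `p A + q B + r` when `A` and `B` are centred. -/
lemma integral_sq_linear {α : Type*} [MeasurableSpace α] (μ : Measure α) [IsProbabilityMeasure μ]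
    {A B : α → ℝ} (hA : MemLp A 2 μ) (hB : MemLp B 2 μ) (hA0 : ∫ x, A x ∂μ = 0)
    (hB0 : ∫ x, B x ∂μ = 0) (p q r : ℝ) :
    ∫ x, (p * A x + q * B x + r) ^ 2 ∂μ = p ^ 2 * ∫ x, A x ^ 2 ∂μ
      + 2 * (p * q) * ∫ x, A x * B x ∂μ + q ^ 2 * ∫ x, B x ^ 2 ∂μ + r ^ 2 := by
  have e : (fun x => (p * A x + q * B x + r) ^ 2) = fun x => (((((p ^ 2 * A x ^ 2)
      + 2 * (p * q) * (A x * B x)) + q ^ 2 * B x ^ 2) + 2 * p * r * A x) + 2 * q * r * B x)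
      + r ^ 2 := by
    funext x; ring
  have iA := (hA.integrable (by norm_num)).const_mul (2 * p * r)
  have iB := (hB.integrable (by norm_num)).const_mul (2 * q * r)
  have iAA := hA.integrable_sq.const_mul (p ^ 2)
  have iBB := hB.integrable_sq.const_mul (q ^ 2)
  have iAB : Integrable (fun x => 2 * (p * q) * (A x * B x)) μ :=
    (hA.integrable_mul hB).const_mul _
  have j1 := iAA.add iAB
  have j2 := j1.add iBB
  have j3 := j2.add iA
  have j4 := j3.add iB
  rw [e, integral_add (by exact j4) (integrable_const _), integral_add (by exact j3) iB,
    integral_add (by exact j2) iA, integral_add (by exact j1) iBB, integral_add iAA iAB]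
  simp only [integral_const_mul, hA0, hB0, integral_const, probReal_univ, smul_eq_mul]
  ring

namespace DegradedCode

variable (c : DegradedCode n K₁ K₂)

/-- The conditional mean of `X₁` given `M₁`. -/
def mean₁ (Q : ℝ≥0) (m₁ : Fin K₁) (i : Fin n) : ℝ := ∫ s, c.enc₁ m₁ s i ∂gaussPi n Q

/-- The conditional mean of `X₂` given `M₁`. -/
def mean₂ (m₁ : Fin K₁) (i : Fin n) : ℝ := (K₂ : ℝ)⁻¹ * ∑ m₂, c.enc₂ m₁ m₂ i

/-- The part of `X₁` that is centred given `M₁`. -/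
def dev₁ (Q : ℝ≥0) (m₁ : Fin K₁) (s : Fin n → ℝ) (i : Fin n) : ℝ := c.enc₁ m₁ s i - c.mean₁ Q m₁ i

/-- The average conditional variance of `X₁` given `M₁`. -/
def var₁ (Q : ℝ≥0) : ℝ := avg fun (m : Fin K₁ × Fin K₂) i => ∫ s, c.dev₁ Q m.1 s i ^ 2 ∂gaussPi n Q

/-- The average correlation of `X₁` with the state. -/
def corr (Q : ℝ≥0) : ℝ :=
  avg fun (m : Fin K₁ × Fin K₂) i => ∫ s, c.dev₁ Q m.1 s i * s i ∂gaussPi n Q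

/-- The average conditional variance of `X₂` given `M₁`. -/
def var₂ : ℝ := avg fun (m : Fin K₁ × Fin K₂) i => (c.enc₂ m.1 m.2 i - c.mean₂ m.1 i) ^ 2

/-- The average power of the conditional mean of `X₁` given `M₁`. -/
def meanPow₁ (Q : ℝ≥0) : ℝ := avg fun (m : Fin K₁ × Fin K₂) i => c.mean₁ Q m.1 i ^ 2

/-- The average power of the conditional mean of `X₂` given `M₁`. -/
def meanPow₂ : ℝ := avg fun (m : Fin K₁ × Fin K₂) i => c.mean₂ m.1 i ^ 2

/-- The average correlation of the two conditional means given `M₁`. -/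
def meanCorr (Q : ℝ≥0) : ℝ := avg fun (m : Fin K₁ × Fin K₂) i => c.mean₁ Q m.1 i * c.mean₂ m.1 i

lemma measurable_dev₁ (m₁ : Fin K₁) : Measurable (c.dev₁ Q m₁) := by
  have := c.measurable_enc₁ m₁
  refine measurable_pi_lambda _ fun i => ?_
  exact ((measurable_pi_apply i).comp this).sub_const _

lemma sum_enc₂_sub_mean₂ (h₂ : 0 < K₂) (m₁ : Fin K₁) (i : Fin n) :
    ∑ m₂, (c.enc₂ m₁ m₂ i - c.mean₂ m₁ i) = 0 := by
  simp [mean₂]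
  field_simp
  ring

/-- Orthogonality: the deviation of `X₂` from its conditional mean averages to zero over `m₂`, hence
is uncorrelated with any function of `m₁`. -/
lemma avg_mul_enc₂_sub_mean₂ (h₂ : 0 < K₂) (f : Fin K₁ → Fin n → ℝ) :
    avg (fun (m : Fin K₁ × Fin K₂) i => f m.1 i * (c.enc₂ m.1 m.2 i - c.mean₂ m.1 i)) = 0 := by
  unfold avg
  rw [Fintype.sum_prod_type, Finset.sum_eq_zero, mul_zero]
  intro m₁ _
  rw [Finset.sum_comm]
  refine Finset.sum_eq_zero fun i _ => ?_
  change ∑ m₂, f m₁ i * (c.enc₂ m₁ m₂ i - c.mean₂ m₁ i) = 0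
  rw [← Finset.mul_sum, c.sum_enc₂_sub_mean₂ h₂, mul_zero]

lemma avg_enc₂_sq (h₂ : 0 < K₂) :
    avg (fun (m : Fin K₁ × Fin K₂) i => c.enc₂ m.1 m.2 i ^ 2) = c.meanPow₂ + c.var₂ := by
  have e : (fun (m : Fin K₁ × Fin K₂) i => c.enc₂ m.1 m.2 i ^ 2) = fun m i =>
      (c.mean₂ m.1 i ^ 2 + (c.enc₂ m.1 m.2 i - c.mean₂ m.1 i) ^ 2)
        + 2 * (c.mean₂ m.1 i * (c.enc₂ m.1 m.2 i - c.mean₂ m.1 i)) := by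
    funext m i; ring
  rw [e, avg_add, avg_add, avg_const_mul, c.avg_mul_enc₂_sub_mean₂ h₂ c.mean₂]
  simp [meanPow₂, var₂]

lemma avg_mean₁_add_enc₂_sq (h₂ : 0 < K₂) :
    avg (fun (m : Fin K₁ × Fin K₂) i => (c.mean₁ Q m.1 i + c.enc₂ m.1 m.2 i) ^ 2)
      = c.meanPow₁ Q + 2 * c.meanCorr Q + c.meanPow₂ + c.var₂ := by
  have e : (fun (m : Fin K₁ × Fin K₂) i => (c.mean₁ Q m.1 i + c.enc₂ m.1 m.2 i) ^ 2) = fun m i =>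
      ((c.mean₁ Q m.1 i ^ 2 + 2 * (c.mean₁ Q m.1 i * c.mean₂ m.1 i)) + c.enc₂ m.1 m.2 i ^ 2)
        + 2 * (c.mean₁ Q m.1 i * (c.enc₂ m.1 m.2 i - c.mean₂ m.1 i)) := by
    funext m i; ring
  rw [e, avg_add, avg_add, avg_add, avg_const_mul, avg_const_mul,
    c.avg_mul_enc₂_sub_mean₂ h₂ (c.mean₁ Q), c.avg_enc₂_sq h₂]
  simp only [meanPow₁, meanCorr]
  ring

lemma meanCorr_sq_le : c.meanCorr Q ^ 2 ≤ c.meanPow₁ Q * c.meanPow₂ := avg_mul_sq_le _ _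

section Moments

variable {c}
variable (hx : ∀ m₁ i, MemLp (fun s => c.enc₁ m₁ s i) 2 (gaussPi n Q))
include hx

lemma memLp_dev₁ (m₁ : Fin K₁) (i : Fin n) :
    MemLp (fun s => c.dev₁ Q m₁ s i) 2 (gaussPi n Q) :=
  (hx m₁ i).sub (memLp_const _)

lemma integral_dev₁ (m₁ : Fin K₁) (i : Fin n) : ∫ s, c.dev₁ Q m₁ s i ∂gaussPi n Q = 0 := by
  unfold dev₁
  rw [integral_sub ((hx m₁ i).integrable (by norm_num)) (integrable_const _)]
  simp [mean₁]

lemma avg_integral_sq (hn : 0 < n) (h₁ : 0 < K₁) (h₂ : 0 < K₂) (p q : ℝ)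
    (r : Fin K₁ × Fin K₂ → Fin n → ℝ) :
    avg (fun (m : Fin K₁ × Fin K₂) i =>
        ∫ s, (p * c.dev₁ Q m.1 s i + q * s i + r m i) ^ 2 ∂gaussPi n Q)
      = p ^ 2 * c.var₁ Q + 2 * (p * q) * c.corr Q + q ^ 2 * Q + avg fun m i => r m i ^ 2 := by
  have e := fun (m : Fin K₁ × Fin K₂) (i : Fin n) => integral_sq_linear (gaussPi n Q)
    (memLp_dev₁ hx m.1 i) (memLp_coord n Q i) (integral_dev₁ hx m.1 i) (integral_coord n Q i)
    p q (r m i)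
  simp only [e, avg_add, avg_const_mul, integral_coord_sq, avg_const hn h₁ h₂]
  rfl

/-- Second moments of linear combinations of the centred part of `X₁`, the state, the noise, and a
function of the messages. -/
lemma integral_law_linear (hn : 0 < n) (h₁ : 0 < K₁) (h₂ : 0 < K₂) (p q a : ℝ)
    (r : Fin K₁ × Fin K₂ → Fin n → ℝ) :
    Integrable (fun ω : Outcome n K₁ K₂ =>
      ∑ i, (p * c.dev₁ Q ω.1.1 ω.2.1 i + q * ω.2.1 i + r ω.1 i + a * ω.2.2 i) ^ 2)
      (law n K₁ K₂ Q) ∧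
    ∫ ω, ∑ i, (p * c.dev₁ Q ω.1.1 ω.2.1 i + q * ω.2.1 i + r ω.1 i + a * ω.2.2 i) ^ 2
      ∂law n K₁ K₂ Q
      = n * (p ^ 2 * c.var₁ Q + 2 * (p * q) * c.corr Q + q ^ 2 * Q
          + avg (fun m i => r m i ^ 2) + a ^ 2) := by
  obtain ⟨hI, hE⟩ := integral_law_sum_sq (n := n) (Q := Q) h₁ h₂
    (F := fun m s i => p * c.dev₁ Q m.1 s i + q * s i + r m i)
    (fun m => measurable_pi_lambda _ fun i =>
      ((((measurable_pi_apply i).comp (c.measurable_dev₁ m.1)).const_mul p).add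
        ((measurable_pi_apply i).const_mul q)).add_const _)
    (fun m i => ((((memLp_dev₁ hx m.1 i).const_mul p).add
      ((memLp_coord n Q i).const_mul q)).add (memLp_const _))) a
  refine ⟨hI, hE.trans ?_⟩
  rw [← mul_avg hn, avg_add, avg_integral_sq hx hn h₁ h₂, avg_const hn h₁ h₂]

/-- A Gaussian log-density is quadratic, so its expectation sees only the second moment of `g - f`.
All relative entropies below are evaluated through this formula. -/
lemma integral_law_logGauss (hn : 0 < n) (h₁ : 0 < K₁) (h₂ : 0 < K₂) (p q a v : ℝ)
    (r : Fin K₁ × Fin K₂ → Fin n → ℝ) {f g : Outcome n K₁ K₂ → Fin n → ℝ}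
    (hfg : ∀ ω i, g ω i - f ω i
      = p * c.dev₁ Q ω.1.1 ω.2.1 i + q * ω.2.1 i + r ω.1 i + a * ω.2.2 i) :
    Integrable (fun ω => logGauss v (f ω) (g ω)) (law n K₁ K₂ Q) ∧
    ∫ ω, logGauss v (f ω) (g ω) ∂law n K₁ K₂ Q
      = -(n / 2 * ((p ^ 2 * c.var₁ Q + 2 * (p * q) * c.corr Q + q ^ 2 * Q
          + avg (fun m i => r m i ^ 2) + a ^ 2) / v + Real.log (2 * Real.pi * v))) := by
  have := isProbabilityMeasure_law (n := n) (Q := Q) h₁ h₂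
  obtain ⟨hI, hE⟩ := integral_law_linear hx hn h₁ h₂ p q a r
  simp only [logGauss, hfg]
  have hI' := (hI.neg.div_const (2 * v))
  refine ⟨by exact hI'.sub (integrable_const _), ?_⟩
  rw [integral_sub (by exact hI') (integrable_const _), integral_div, integral_neg, hE]
  simp only [integral_const, probReal_univ, smul_eq_mul, one_mul]
  rw [neg_div, mul_div_mul_comm]
  ring

/-- Cauchy–Schwarz, read off from the nonnegative average second moment of `dev₁ + t * S` for all
real `t`. -/
lemma corr_sq_le (hn : 0 < n) (h₁ : 0 < K₁) (h₂ : 0 < K₂) :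
    c.corr Q ^ 2 ≤ c.var₁ Q * Q := by
  refine sq_le_mul_of_forall_quadratic_nonneg fun t => ?_
  have h := avg_integral_sq hx hn h₁ h₂ 1 t 0
  have h0 : avg (fun (m : Fin K₁ × Fin K₂) i => (0 : Fin K₁ × Fin K₂ → Fin n → ℝ) m i ^ 2) = 0 := by
    simp [avg]
  rw [h0] at h
  have : 0 ≤ avg (fun (m : Fin K₁ × Fin K₂) i => ∫ s, (1 * c.dev₁ Q m.1 s i + t * s i
      + (0 : Fin K₁ × Fin K₂ → Fin n → ℝ) m i) ^ 2 ∂gaussPi n Q) :=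
    avg_nonneg fun m i => integral_nonneg fun s => sq_nonneg _
  rw [h] at this
  linarith

end Moments

end DegradedCode

end DirtyMAC

/-! ### Rate bounds for one code. -/

namespace DirtyMAC

open scoped ENNReal

variable {n K₁ K₂ : ℕ} {Q : ℝ≥0}

namespace DegradedCode

variable {c : DegradedCode n K₁ K₂}

lemma var₁_nonneg : 0 ≤ c.var₁ Q :=
  avg_nonneg fun _ _ => integral_nonneg fun _ => sq_nonneg _

lemma var₂_nonneg : 0 ≤ c.var₂ := avg_nonneg fun _ _ => sq_nonneg _

lemma meanPow₁_nonneg : 0 ≤ c.meanPow₁ Q := avg_nonneg fun _ _ => sq_nonneg _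

lemma meanPow₂_nonneg : 0 ≤ c.meanPow₂ := avg_nonneg fun _ _ => sq_nonneg _

variable (c) in
/-- The average conditional variance of `X₁ + S + Z` given `M₁`. -/
def varV (Q : ℝ≥0) : ℝ := 1 + Q + 2 * c.corr Q + c.var₁ Q

variable (c) in
/-- The average residual variance of `X₁` given `M₁` after linear prediction from the state. -/
def resVar₁ (Q : ℝ≥0) : ℝ := c.var₁ Q - c.corr Q ^ 2 / Q

section

variable (hx : ∀ m₁ i, MemLp (fun s => c.enc₁ m₁ s i) 2 (gaussPi n Q))
  (hn : 0 < n) (h₁ : 0 < K₁) (h₂ : 0 < K₂)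
include hx hn h₁ h₂

lemma one_le_varV : 1 ≤ c.varV Q := by
  have h := corr_sq_le hx hn h₁ h₂
  have hv : 0 ≤ c.var₁ Q := var₁_nonneg
  have hQ : (0 : ℝ) ≤ Q := Q.2
  have : |2 * c.corr Q| ≤ Q + c.var₁ Q := by
    refine abs_le_of_sq_le_sq ?_ (by positivity)
    nlinarith [sq_nonneg (c.var₁ Q - Q)]
  unfold varV
  linarith [neg_le_of_abs_le this]

lemma resVar₁_nonneg : 0 ≤ c.resVar₁ Q := by
  have h := corr_sq_le hx hn h₁ h₂
  have hv : 0 ≤ c.var₁ Q := var₁_nonneg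
  exact sub_nonneg.2 (div_le_of_le_mul₀ Q.2 hv h)

lemma corr_eq_zero (hQ : Q = 0) : c.corr Q = 0 := by
  have h := corr_sq_le hx hn h₁ h₂
  rw [hQ] at h ⊢
  simpa using h

/-- Bound obtained by giving the state to the decoder. -/
theorem log_card₂_le_of_state :
    (1 - c.errorProb Q) * Real.log K₂ - Real.log 2 ≤ n / 2 * Real.log (1 + c.var₂) := by
  have hβ : 0 ≤ c.var₂ := var₂_nonneg
  set v := 1 + c.var₂ with hv
  have hv0 : 0 < v := by positivity
  have hk₁ : (K₁ : ℝ) ≠ 0 := by exact_mod_cast h₁.ne'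
  -- The reference replaces the contribution of `X₂` by its conditional mean given `M₁` and widens
  -- the noise variance by `var₂`. It does not depend on `m₂`, whence `J = K₁` below.
  let W : Fin K₁ × Fin K₂ → (Fin n → ℝ) → (Fin n → ℝ) → ℝ := fun m s y =>
    logGauss v (c.enc₁ m.1 s + s + c.mean₂ m.1) y
  obtain ⟨hI, hE⟩ := integral_law_logGauss hx hn h₁ h₂ 0 0 1 v
    (fun m i => c.enc₂ m.1 m.2 i - c.mean₂ m.1 i)
    (f := fun ω => c.enc₁ ω.1.1 ω.2.1 + ω.2.1 + c.mean₂ ω.1.1) (g := c.Y)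
    (fun ω i => by simp only [Y, X₁, X₂, Pi.add_apply]; ring)
  obtain ⟨hIz, hEz⟩ := integral_law_logGauss hx hn h₁ h₂ 0 0 1 1 (fun _ _ => 0)
    (f := fun _ => 0) (g := fun ω => ω.2.2) (fun ω i => by simp)
  have hu : ∀ m s, ∫⁻ y, ENNReal.ofReal (Real.exp (W m s y)) = 1 := fun m s =>
    lintegral_exp_logGauss hv0 _
  have hWm : ∀ m, Measurable fun p : (Fin n → ℝ) × (Fin n → ℝ) => W m p.1 p.2 := fun m =>
    measurable_logGauss_comp v ((((c.measurable_enc₁ m.1).comp measurable_fst).add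
      measurable_fst).add_const _) measurable_snd
  have key := c.log_card_le_of_reference (Q := Q) h₁ h₂ (W := W) hWm (hI.sub hIz)
    (fun m => by simp [hu]) h₁ (by
      rw [← lintegral_finsetSum' _ fun m _ => ?_]
      · calc _ ≤ ∫⁻ _s, (K₁ : ℝ≥0∞) ∂gaussPi n Q := lintegral_mono fun s =>
              c.sum_setLIntegral_dec_le'
                (f := fun m₁ y => ENNReal.ofReal
                  (Real.exp (logGauss v (c.enc₁ m₁ s + s + c.mean₂ m₁) y)))
                fun m₁ => (lintegral_exp_logGauss hv0 _).le
          _ = K₁ := by simp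
      · exact ((hWm m).exp.ennreal_ofReal.lintegral_prod_right').aemeasurable)
  have hsub : ∫ ω, (W ω.1 ω.2.1 (c.Y ω) - logGauss 1 0 ω.2.2) ∂law n K₁ K₂ Q
      = -(n / 2 * Real.log v) := by
    rw [integral_sub (by exact hI) (by exact hIz)]
    change ∫ ω, logGauss v (c.enc₁ ω.1.1 ω.2.1 + ω.2.1 + c.mean₂ ω.1.1) (c.Y ω) ∂law n K₁ K₂ Q
      - _ = _
    rw [hE, hEz]
    have h0 : avg (fun (_ : Fin K₁ × Fin K₂) (_ : Fin n) => (0 : ℝ) ^ 2) = 0 := by simp [avg]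
    -- The variance `v` equals the actual second moment, so the quadratic terms of output and noise
    -- both equal `n / 2` and cancel; only the logarithms remain.
    have hvv : avg (fun (m : Fin K₁ × Fin K₂) i => (c.enc₂ m.1 m.2 i - c.mean₂ m.1 i) ^ 2) + 1 = v :=
      add_comm _ _
    rw [h0, Real.log_mul (by positivity) hv0.ne']
    simp only [ne_eq, OfNat.ofNat_ne_zero, not_false_eq_true, zero_pow, zero_mul, mul_zero,
      zero_add, one_pow, mul_one, hvv, div_self hv0.ne', div_one]
    ring
  rw [hsub, mul_div_cancel_left₀ _ hk₁] at key
  linarith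

/-- Bound obtained from a Gaussian reference law of the output with mean `μ m₁`, together with
linear estimation of the state from the output. -/
theorem log_card_le_of_mean (μ : Fin K₁ → Fin n → ℝ) {J : ℕ} (hJ : 0 < J) {v : ℝ}
    (hv : v = c.varV Q
      + avg fun (m : Fin K₁ × Fin K₂) i => (c.mean₁ Q m.1 i + c.enc₂ m.1 m.2 i - μ m.1 i) ^ 2)
    (hdec : ∑ m, ∫⁻ y in c.dec ⁻¹' {m}, ENNReal.ofReal (Real.exp (logGauss v (μ m.1) y)) ≤ J) :
    (1 - c.errorProb Q) * Real.log (K₁ * K₂ / J) - Real.log 2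
      ≤ n / 2 * Real.log (v * ((1 + c.resVar₁ Q) / c.varV Q)) := by
  have hV := one_le_varV hx hn h₁ h₂
  have hT := resVar₁_nonneg hx hn h₁ h₂
  have hV0 : 0 < c.varV Q := by linarith
  have hv0 : 0 < v := by
    have : 0 ≤ avg fun (m : Fin K₁ × Fin K₂) i =>
        (c.mean₁ Q m.1 i + c.enc₂ m.1 m.2 i - μ m.1 i) ^ 2 := avg_nonneg fun _ _ => sq_nonneg _
    linarith
  -- `α` is the coefficient of the best linear estimate of `S` from `dev₁ + S + Z`, with covariance
  -- `Q + corr` and variance `varV`; `θ` is its error variance.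
  set ratio := (1 + c.resVar₁ Q) / c.varV Q with hratio
  have hr0 : 0 < ratio := by positivity
  set θ := Q * ratio with hθ
  set α := (Q + c.corr Q) / c.varV Q with hα
  have hQθ : Q ≠ 0 → 0 < θ := fun hQ => by positivity
  have hQ0 : Q = 0 → θ = 0 := fun hQ => by simp [hθ, hQ]
  let est : Fin K₁ × Fin K₂ → (Fin n → ℝ) → Fin n → ℝ := fun m y i =>
    α * (y i - c.enc₂ m.1 m.2 i - c.mean₁ Q m.1 i)
  let W : Fin K₁ × Fin K₂ → (Fin n → ℝ) → (Fin n → ℝ) → ℝ := fun m s y =>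
    logGauss v (μ m.1) y + (logGauss θ (est m y) s - logGauss Q 0 s)
  have hest : ∀ m, Measurable (est m) := fun m => measurable_pi_lambda _ fun i => by
    simp only [est]; fun_prop
  have hψm : ∀ m, Measurable fun p : (Fin n → ℝ) × (Fin n → ℝ) =>
      logGauss θ (est m p.2) p.1 - logGauss Q 0 p.1 := fun m =>
    (measurable_logGauss_comp θ ((hest m).comp measurable_snd) measurable_fst).sub
      (measurable_logGauss_comp _ measurable_const measurable_fst)
  have hφm : ∀ m : Fin K₁ × Fin K₂, Measurable (logGauss v (μ m.1)) := fun m =>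
    measurable_logGauss_comp v measurable_const measurable_id
  have hWm : ∀ m, Measurable fun p : (Fin n → ℝ) × (Fin n → ℝ) => W m p.1 p.2 := fun m =>
    ((hφm m).comp measurable_snd).add (hψm m)
  have hWle : ∀ m B, ∫⁻ s, ∫⁻ y in B, ENNReal.ofReal (Real.exp (W m s y)) ∂volume ∂gaussPi n Q
      ≤ ∫⁻ y in B, ENNReal.ofReal (Real.exp (logGauss v (μ m.1) y)) := fun m B =>
    lintegral_reference_le (hφm m) (hψm m)
      (fun y => lintegral_exp_logGauss_sub hQθ hQ0 (est m y)) B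
  obtain ⟨hIy, hEy⟩ := integral_law_logGauss hx hn h₁ h₂ 1 1 1 v
    (fun m i => c.mean₁ Q m.1 i + c.enc₂ m.1 m.2 i - μ m.1 i)
    (f := fun ω => μ ω.1.1) (g := c.Y)
    (fun ω i => by simp only [Y, X₁, X₂, dev₁, Pi.add_apply]; ring)
  -- The estimation error is `S - α * (dev₁ + S + Z)`, which gives the coefficients `-α`, `1 - α`,
  -- `-α`.
  obtain ⟨hIe, hEe⟩ := integral_law_logGauss hx hn h₁ h₂ (-α) (1 - α) (-α) θ (fun _ _ => 0)
    (f := fun ω => est ω.1 (c.Y ω)) (g := fun ω => ω.2.1)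
    (fun ω i => by simp only [est, Y, X₁, X₂, dev₁, Pi.add_apply]; ring)
  obtain ⟨hIs, hEs⟩ := integral_law_logGauss hx hn h₁ h₂ 0 1 0 Q (fun _ _ => 0)
    (f := fun _ => 0) (g := fun ω => ω.2.1) (fun ω i => by simp)
  obtain ⟨hIz, hEz⟩ := integral_law_logGauss hx hn h₁ h₂ 0 0 1 1 (fun _ _ => 0)
    (f := fun _ => 0) (g := fun ω => ω.2.2) (fun ω i => by simp)
  have key := c.log_card_le_of_reference (Q := Q) h₁ h₂ (W := W) hWm
    ((hIy.add (hIe.sub hIs)).sub hIz)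
    (fun m => by
      have h := hWle m Set.univ
      simp only [Measure.restrict_univ] at h
      exact h.trans (lintegral_exp_logGauss hv0 _).le) hJ
    ((Finset.sum_le_sum fun m _ => hWle m _).trans hdec)
  have h0 : avg (fun (_ : Fin K₁ × Fin K₂) (_ : Fin n) => (0 : ℝ) ^ 2) = 0 := by simp [avg]
  have hEy' : 1 ^ 2 * c.var₁ Q + 2 * (1 * 1) * c.corr Q + 1 ^ 2 * (Q : ℝ)
      + avg (fun (m : Fin K₁ × Fin K₂) i =>
        (c.mean₁ Q m.1 i + c.enc₂ m.1 m.2 i - μ m.1 i) ^ 2) + 1 ^ 2 = v := by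
    rw [hv, varV]; ring
  have hlogθ : (Q : ℝ) ≠ 0 → Real.log (2 * Real.pi * θ)
      = Real.log (2 * Real.pi * Q) + Real.log ratio := fun hQ => by
    rw [hθ, ← mul_assoc, Real.log_mul (by positivity) hr0.ne']
  have hEsum : ∫ ω, (W ω.1 ω.2.1 (c.Y ω) - logGauss 1 0 ω.2.2) ∂law n K₁ K₂ Q
      = -(n / 2 * Real.log (v * ratio)) := by
    rw [integral_sub (by exact hIy.add (hIe.sub hIs)) (by exact hIz),
      integral_add (by exact hIy) (by exact hIe.sub hIs), integral_sub (by exact hIe) (by exact hIs),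
      hEy, hEe, hEs, hEz, hEy', h0, div_self hv0.ne', Real.log_mul hv0.ne' hr0.ne',
      Real.log_mul (by positivity) hv0.ne']
    -- Without state the two state terms vanish, by the convention for variance zero, and the ratio
    -- is `1`.
    by_cases hQ : Q = 0
    · have hk := corr_eq_zero hx hn h₁ h₂ hQ
      have hr1 : ratio = 1 := by
        rw [hratio, resVar₁, varV, hk, hQ]
        have : 0 ≤ c.var₁ 0 := var₁_nonneg
        simp only [NNReal.coe_zero]
        field_simp
        ring
      simp [hr1, hθ, hQ]
      ring
    · have hQ' : (Q : ℝ) ≠ 0 := by exact_mod_cast hQ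
      have hres : (-α) ^ 2 * c.var₁ Q + 2 * (-α * (1 - α)) * c.corr Q + (1 - α) ^ 2 * (Q : ℝ) + 0
          + (-α) ^ 2 = θ := by
        have e1 : (-α) ^ 2 * c.var₁ Q + 2 * (-α * (1 - α)) * c.corr Q + (1 - α) ^ 2 * (Q : ℝ) + 0
          + (-α) ^ 2 = Q - 2 * α * (Q + c.corr Q) + α ^ 2 * c.varV Q := by rw [varV]; ring
        rw [e1, hθ, hratio, hα, resVar₁]
        have e2 : c.var₁ Q = c.varV Q - 1 - Q - 2 * c.corr Q := by rw [varV]; ring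
        rw [e2]
        field_simp
        ring
      rw [hres, hlogθ hQ', div_self (hQθ hQ).ne']
      simp only [ne_eq, OfNat.ofNat_ne_zero, not_false_eq_true, zero_pow, zero_mul, mul_zero,
        zero_add, one_pow, mul_one, one_mul, add_zero, div_self hQ', div_one]
      ring
  rw [hEsum] at key
  linarith

/-- Bound on the private rate of the non-cognitive encoder, given the other message. -/
theorem log_card₂_le :
    (1 - c.errorProb Q) * Real.log K₂ - Real.log 2
      ≤ n / 2 * Real.log ((c.varV Q + c.var₂) * ((1 + c.resVar₁ Q) / c.varV Q)) := by
  have hk₁ : (K₁ : ℝ) ≠ 0 := by exact_mod_cast h₁.ne'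
  have hV := one_le_varV hx hn h₁ h₂
  have hβ : 0 ≤ c.var₂ := var₂_nonneg
  -- The reference mean is the conditional mean of the output given `M₁`, so the extra variance is
  -- that of `X₂` given `M₁`.
  have h := log_card_le_of_mean hx hn h₁ h₂ (fun m₁ i => c.mean₁ Q m₁ i + c.mean₂ m₁ i) h₁
    (v := c.varV Q + c.var₂) (by simp only [add_sub_add_left_eq_sub]; rfl)
    (c.sum_setLIntegral_dec_le' (f := fun m₁ y => ENNReal.ofReal (Real.exp
      (logGauss (c.varV Q + c.var₂) (fun i => c.mean₁ Q m₁ i + c.mean₂ m₁ i) y)))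
      fun m₁ => (lintegral_exp_logGauss (by linarith) _).le)
  rwa [mul_div_cancel_left₀ _ hk₁] at h

/-- Bound on the sum rate. -/
theorem log_card_mul_le :
    (1 - c.errorProb Q) * Real.log (K₁ * K₂) - Real.log 2
      ≤ n / 2 * Real.log ((c.varV Q + (c.meanPow₁ Q + 2 * c.meanCorr Q + c.meanPow₂ + c.var₂))
        * ((1 + c.resVar₁ Q) / c.varV Q)) := by
  have hV := one_le_varV hx hn h₁ h₂
  have hm : 0 ≤ c.meanPow₁ Q + 2 * c.meanCorr Q + c.meanPow₂ + c.var₂ := by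
    rw [← c.avg_mean₁_add_enc₂_sq h₂]
    exact avg_nonneg fun _ _ => sq_nonneg _
  -- A centred reference ignores both messages, so `J = 1`, at the price of the full power of the
  -- message-dependent mean.
  have h := log_card_le_of_mean hx hn h₁ h₂ (fun _ _ => 0) one_pos
    (v := c.varV Q + (c.meanPow₁ Q + 2 * c.meanCorr Q + c.meanPow₂ + c.var₂))
    (by simp only [sub_zero, c.avg_mean₁_add_enc₂_sq h₂])
    ((c.sum_setLIntegral_dec_le _).trans (by
      rw [lintegral_exp_logGauss (by linarith)]; simp))
  rwa [Nat.cast_one, div_one] at h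

end

lemma memLp_enc₁ {P₁ P₂ : ℝ≥0} (h₁ : 0 < K₁) (h₂ : 0 < K₂) (hP : c.PowerConstraint P₁ P₂ Q)
    (m₁ : Fin K₁) (i : Fin n) : MemLp (fun s => c.enc₁ m₁ s i) 2 (gaussPi n Q) := by
  have hm : Measurable fun s => c.enc₁ m₁ s i :=
    (measurable_pi_apply i).comp (c.measurable_enc₁ m₁)
  rw [memLp_two_iff_integrable_sq hm.aestronglyMeasurable]
  have h := integrable_of_integrable_law h₁ h₂ (hP.1 i) (m₁, ⟨0, h₂⟩)
  exact (measurePreserving_fst.integrable_comp (hm.pow_const 2).aestronglyMeasurable).1 h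

lemma power₁ {P₁ P₂ : ℝ≥0} (hn : 0 < n) (h₁ : 0 < K₁) (h₂ : 0 < K₂)
    (hP : c.PowerConstraint P₁ P₂ Q) : c.meanPow₁ Q + c.var₁ Q ≤ P₁ := by
  have hx := memLp_enc₁ h₁ h₂ hP
  -- Adding the conditional mean back to `dev₁` recovers `X₁`, and the cross term vanishes since
  -- `dev₁` is centred.
  obtain ⟨-, hE⟩ := integral_law_linear hx hn h₁ h₂ 1 0 0 (fun m i => c.mean₁ Q m.1 i)
  have h := hP.2.1
  rw [← integral_finsetSum _ fun i _ => hP.1 i] at h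
  have e : ∀ ω : Outcome n K₁ K₂, ∑ i, (1 * c.dev₁ Q ω.1.1 ω.2.1 i + 0 * ω.2.1 i
      + c.mean₁ Q ω.1.1 i + 0 * ω.2.2 i) ^ 2 = ∑ i, c.X₁ ω i ^ 2 := fun ω =>
    Finset.sum_congr rfl fun i _ => by simp only [dev₁, X₁]; ring
  simp only [e] at hE
  rw [hE] at h
  have hn' : (0 : ℝ) < n := by exact_mod_cast hn
  have := le_of_mul_le_mul_left h hn'
  simp only [meanPow₁]
  linarith

lemma power₂ {P₁ P₂ : ℝ≥0} (hn : 0 < n) (h₁ : 0 < K₁) (h₂ : 0 < K₂)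
    (hP : c.PowerConstraint P₁ P₂ Q) : c.meanPow₂ + c.var₂ ≤ P₂ := by
  have hx := memLp_enc₁ h₁ h₂ hP
  obtain ⟨-, hE⟩ := integral_law_linear hx hn h₁ h₂ 0 0 0 (fun m i => c.enc₂ m.1 m.2 i)
  have h := hP.2.2.2
  rw [← integral_finsetSum _ fun i _ => hP.2.2.1 i] at h
  have e : ∀ ω : Outcome n K₁ K₂, ∑ i, (0 * c.dev₁ Q ω.1.1 ω.2.1 i + 0 * ω.2.1 i
      + c.enc₂ ω.1.1 ω.1.2 i + 0 * ω.2.2 i) ^ 2 = ∑ i, c.X₂ ω i ^ 2 := fun ω =>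
    Finset.sum_congr rfl fun i _ => by simp only [X₂]; ring
  simp only [e] at hE
  rw [hE, c.avg_enc₂_sq h₂] at h
  have hn' : (0 : ℝ) < n := by exact_mod_cast hn
  have := le_of_mul_le_mul_left h hn'
  linarith

end DegradedCode

end DirtyMAC

/-! ### Correlation parameters and closedness of the outer region. -/

namespace DirtyMAC

open scoped ENNReal

/-- The correlation parameters `(ρ₁, ρ₂, ρs)`. -/
def corrParams : Set (ℝ × ℝ × ℝ) :=
  (Set.Icc 0 1 ×ˢ (Set.Icc 0 1 ×ˢ Set.Icc (-1) 0)) ∩ {ρ | ρ.1 ^ 2 + ρ.2.2 ^ 2 ≤ 1}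

lemma isCompact_corrParams : IsCompact corrParams :=
  (isCompact_Icc.prod (isCompact_Icc.prod isCompact_Icc)).inter_right
    (isClosed_le (by fun_prop) continuous_const)

/-- The residual power of the first encoder. -/
def resPow (P₁ : ℝ≥0) (ρ : ℝ × ℝ × ℝ) : ℝ := P₁ * (1 - ρ.1 ^ 2 - ρ.2.2 ^ 2)

/-- The variance of the interference and the noise. -/
def interf (P₁ Q : ℝ≥0) (ρ : ℝ × ℝ × ℝ) : ℝ :=
  1 + (√(Q : ℝ) + ρ.2.2 * √(P₁ : ℝ)) ^ 2 + resPow P₁ ρ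

/-- The private power of the second encoder. -/
def privPow (P₂ : ℝ≥0) (ρ : ℝ × ℝ × ℝ) : ℝ := P₂ * (1 - ρ.2.1 ^ 2)

/-- The power of the coherently combined common signals. -/
def cohPow (P₁ P₂ : ℝ≥0) (ρ : ℝ × ℝ × ℝ) : ℝ := (ρ.2.1 * √(P₂ : ℝ) + ρ.1 * √(P₁ : ℝ)) ^ 2

/-- The region defined by the three rate inequalities for fixed correlation parameters. -/
def RateBounds (b : ℝ) (P₁ P₂ Q : ℝ≥0) (ρ : ℝ × ℝ × ℝ) (R : ℝ × ℝ) : Prop :=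
  R.2 ≤ 1 / 2 * Real.logb b (1 + privPow P₂ ρ) ∧
  R.2 ≤ 1 / 2 * Real.logb b (1 + resPow P₁ ρ)
      + 1 / 2 * Real.logb b (1 + privPow P₂ ρ / interf P₁ Q ρ) ∧
  R.1 + R.2 ≤ 1 / 2 * Real.logb b (1 + resPow P₁ ρ)
      + 1 / 2 * Real.logb b (1 + (privPow P₂ ρ + cohPow P₁ P₂ ρ) / interf P₁ Q ρ)

lemma resPow_nonneg (P₁ : ℝ≥0) {ρ : ℝ × ℝ × ℝ} (hρ : ρ ∈ corrParams) : 0 ≤ resPow P₁ ρ :=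
  mul_nonneg P₁.2 (by have : ρ.1 ^ 2 + ρ.2.2 ^ 2 ≤ 1 := hρ.2; linarith)

lemma interf_pos (P₁ Q : ℝ≥0) {ρ : ℝ × ℝ × ℝ} (hρ : ρ ∈ corrParams) : 0 < interf P₁ Q ρ := by
  have := resPow_nonneg P₁ hρ
  unfold interf
  positivity

lemma privPow_nonneg (P₂ : ℝ≥0) {ρ : ℝ × ℝ × ℝ} (hρ : ρ ∈ corrParams) : 0 ≤ privPow P₂ ρ := by
  obtain ⟨h0, h1⟩ := hρ.1.2.1
  exact mul_nonneg P₂.2 (by nlinarith)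

lemma isClosed_setOf_exists_rateBounds (b : ℝ) (P₁ P₂ Q : ℝ≥0) :
    IsClosed {R : ℝ × ℝ | ∃ ρ ∈ corrParams, RateBounds b P₁ P₂ Q ρ R} := by
  have := isCompact_iff_compactSpace.1 isCompact_corrParams
  have hlog : ∀ {f : corrParams × ℝ × ℝ → ℝ}, Continuous f → (∀ x, 0 < f x) →
      Continuous fun x => Real.logb b (f x) := fun hf h0 =>
    (hf.log fun x => (h0 x).ne').div_const _
  have cres : Continuous fun x : corrParams × ℝ × ℝ => resPow P₁ x.1 := by
    unfold resPow; fun_prop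
  have cpriv : Continuous fun x : corrParams × ℝ × ℝ => privPow P₂ x.1 := by
    unfold privPow; fun_prop
  have ccoh : Continuous fun x : corrParams × ℝ × ℝ => cohPow P₁ P₂ x.1 := by
    unfold cohPow; fun_prop
  have cint : Continuous fun x : corrParams × ℝ × ℝ => interf P₁ Q x.1 := by
    unfold interf resPow; fun_prop
  have hr : ∀ x : corrParams × ℝ × ℝ, 0 ≤ resPow P₁ x.1 := fun x => resPow_nonneg P₁ x.1.2
  have hp : ∀ x : corrParams × ℝ × ℝ, 0 ≤ privPow P₂ x.1 := fun x => privPow_nonneg P₂ x.1.2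
  have hi : ∀ x : corrParams × ℝ × ℝ, 0 < interf P₁ Q x.1 := fun x => interf_pos P₁ Q x.1.2
  have hc : ∀ x : corrParams × ℝ × ℝ, 0 ≤ cohPow P₁ P₂ x.1 := fun x => sq_nonneg _
  have l1 := hlog (continuous_const.add cpriv) fun x => add_pos_of_pos_of_nonneg one_pos (hp x)
  have l2 := hlog (continuous_const.add cres) fun x => add_pos_of_pos_of_nonneg one_pos (hr x)
  have l3 := hlog (continuous_const.add (cpriv.div cint fun x => (hi x).ne')) fun x =>
    add_pos_of_pos_of_nonneg one_pos (div_nonneg (hp x) (hi x).le)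
  have l4 := hlog (continuous_const.add ((cpriv.add ccoh).div cint fun x => (hi x).ne')) fun x =>
    add_pos_of_pos_of_nonneg one_pos (div_nonneg (add_nonneg (hp x) (hc x)) (hi x).le)
  have hcl : IsClosed {x : corrParams × ℝ × ℝ | RateBounds b P₁ P₂ Q x.1 x.2} := by
    refine (isClosed_le (by fun_prop) (l1.const_mul _)).inter
      ((isClosed_le (by fun_prop) ((l2.const_mul _).add (l3.const_mul _))).inter
        (isClosed_le (by fun_prop) ((l2.const_mul _).add (l4.const_mul _))))
  -- The region is the projection of a closed set along the compact parameter space, and such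
  -- projections are closed maps.
  convert isClosedMap_snd_of_compactSpace _ hcl using 1
  ext R
  constructor
  · rintro ⟨ρ, hρ, h⟩
    exact ⟨(⟨ρ, hρ⟩, R), h, rfl⟩
  · rintro ⟨⟨ρ, R'⟩, h, rfl⟩
    exact ⟨ρ, ρ.2, h⟩

/-- The left side equals `(1 + T) + N * (1 + T) / (1 + A + T)`, whose fraction increases in `T` and
decreases in `A`. Here `T` is the residual power of `X₁`, `A` the residual state interference, and
`N` the message-bearing power. -/
lemma gain_mono {N N' A A' T T' : ℝ} (hN : 0 ≤ N) (hNN : N ≤ N') (hA : 0 ≤ A') (hAA : A' ≤ A)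
    (hT : 0 ≤ T) (hTT : T ≤ T') :
    (1 + A + T + N) * ((1 + T) / (1 + A + T)) ≤ (1 + T') * (1 + N' / (1 + A' + T')) := by
  have h1 : (1 + T) / (1 + A + T) ≤ (1 + T') / (1 + A' + T') := by
    rw [div_le_div_iff₀ (by linarith) (by linarith)]
    nlinarith [mul_le_mul (add_le_add_right hTT 1) hAA hA (by linarith)]
  have h2 : 0 ≤ (1 + T) / (1 + A + T) := div_nonneg (by linarith) (by linarith)
  calc _ = (1 + T) + N * ((1 + T) / (1 + A + T)) := by
        rw [add_mul _ N, mul_div_cancel₀ _ (by linarith : (1 + A + T) ≠ 0)]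
    _ ≤ (1 + T') + N' * ((1 + T') / (1 + A' + T')) :=
        add_le_add (by linarith) (mul_le_mul hNN h1 h2 (by linarith))
    _ = _ := by ring

/-- Power of `X₁` not spent on its conditional mean or on the part linear in the state is declared
residual, and that of `X₂` not spent on its mean is declared private; so unused power is credited to
the bound. If `Q = 0`, then `hk` forces `k = 0`. -/
lemma exists_corrParams {P₁ P₂ Q : ℝ≥0} {μ₁ τ k μ₂ β : ℝ} (hμ₁ : 0 ≤ μ₁) (hτ : 0 ≤ τ)
    (hμ₂ : 0 ≤ μ₂) (hβ : 0 ≤ β) (h₁ : μ₁ + τ ≤ P₁) (h₂ : μ₂ + β ≤ P₂) (hk : k ^ 2 ≤ τ * Q) :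
    ∃ ρ ∈ corrParams, resPow P₁ ρ = P₁ - μ₁ - k ^ 2 / Q ∧ privPow P₂ ρ = P₂ - μ₂ ∧
      cohPow P₁ P₂ ρ = (√μ₂ + √μ₁) ^ 2 ∧
      (√(Q : ℝ) + ρ.2.2 * √(P₁ : ℝ)) ^ 2 = Q - 2 * |k| + k ^ 2 / Q := by
  have hP₁ : (0 : ℝ) ≤ P₁ := P₁.2
  have hP₂ : (0 : ℝ) ≤ P₂ := P₂.2
  have hQ : (0 : ℝ) ≤ Q := Q.2
  have hkQ : k ^ 2 / Q ≤ τ := div_le_of_le_mul₀ hQ hτ hk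
  have hkQ0 : 0 ≤ k ^ 2 / Q := by positivity
  have scale : ∀ {x P : ℝ}, 0 ≤ x → x ≤ P → √(x / P) ∈ Set.Icc (0 : ℝ) 1 ∧ √(x / P) * √P = √x ∧
      P * √(x / P) ^ 2 = x := by
    intro x P hx hxP
    have hP : 0 ≤ P := hx.trans hxP
    have e : x / P * P = x := by
      rcases hP.eq_or_lt with h | h
      · rw [← h] at hxP ⊢; simp; linarith
      · field_simp
    refine ⟨⟨Real.sqrt_nonneg _, Real.sqrt_le_one.2 (div_le_one_of_le₀ hxP hP)⟩, ?_, ?_⟩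
    · rw [← Real.sqrt_mul (by positivity), e]
    · rw [Real.sq_sqrt (by positivity), mul_comm, e]
  obtain ⟨a1, a2, a3⟩ := scale hμ₁ (by linarith : μ₁ ≤ P₁)
  obtain ⟨b1, b2, b3⟩ := scale hμ₂ (by linarith : μ₂ ≤ P₂)
  obtain ⟨c1, c2, c3⟩ := scale hkQ0 (by linarith : k ^ 2 / Q ≤ P₁)
  have hsk : √(Q : ℝ) * √(k ^ 2 / Q) = |k| := by
    rw [← Real.sqrt_mul hQ, ← Real.sqrt_sq_eq_abs]
    congr 1
    rcases hQ.eq_or_lt with h | h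
    · rw [← h] at hk ⊢; simp at hk ⊢; simp [hk]
    · field_simp
  -- Each correlation is the square root of a fraction of power. The third is taken nonpositive
  -- whatever the sign of `k`: cancelling the state can only help.
  refine ⟨(√(μ₁ / P₁), √(μ₂ / P₂), -√(k ^ 2 / Q / P₁)), ⟨⟨a1, b1, ?_⟩, ?_⟩, ?_, ?_, ?_, ?_⟩
  · exact ⟨by linarith [c1.2], by linarith [c1.1]⟩
  · change √(μ₁ / P₁) ^ 2 + (-√(k ^ 2 / Q / P₁)) ^ 2 ≤ 1
    rw [neg_sq, Real.sq_sqrt (by positivity), Real.sq_sqrt (by positivity), ← add_div]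
    exact div_le_one_of_le₀ (by linarith) hP₁
  · simp only [resPow, neg_sq, mul_sub, a3, c3, mul_one]
  · simp only [privPow, mul_sub, b3, mul_one]
  · simp only [cohPow, a2, b2]
  · simp only [neg_mul, c2]
    have e1 := Real.sq_sqrt hQ
    have e2 := Real.sq_sqrt hkQ0
    nlinarith

/-! ### From one code to the capacity region. -/

namespace DegradedCode

variable {n K₁ K₂ : ℕ} {Q : ℝ≥0} {c : DegradedCode n K₁ K₂}

/-- Single-letter outer bound for one code of finite block length. -/
theorem exists_rateBounds {b : ℝ} (hb : 1 < b) {P₁ P₂ : ℝ≥0} (hn : 0 < n) (h₁ : 0 < K₁)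
    (h₂ : 0 < K₂) (hP : c.PowerConstraint P₁ P₂ Q) {R : ℝ × ℝ}
    (hR₂ : n * R.2 * Real.log b ≤ (1 - c.errorProb Q) * Real.log K₂ - Real.log 2)
    (hR : n * (R.1 + R.2) * Real.log b ≤ (1 - c.errorProb Q) * Real.log (K₁ * K₂) - Real.log 2) :
    ∃ ρ ∈ corrParams, RateBounds b P₁ P₂ Q ρ R := by
  have hx := memLp_enc₁ h₁ h₂ hP
  have hp₁ := power₁ hn h₁ h₂ hP
  have hp₂ := power₂ hn h₁ h₂ hP
  have hτ : 0 ≤ c.var₁ Q := var₁_nonneg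
  have hβ : 0 ≤ c.var₂ := var₂_nonneg
  have hμ₁ : 0 ≤ c.meanPow₁ Q := meanPow₁_nonneg
  have hμ₂ : 0 ≤ c.meanPow₂ := meanPow₂_nonneg
  have hk := corr_sq_le hx hn h₁ h₂
  have hT := resVar₁_nonneg hx hn h₁ h₂
  have hlogb : 0 < Real.log b := Real.log_pos hb
  have hn' : (0 : ℝ) < n := by exact_mod_cast hn
  obtain ⟨ρ, hρ, hres, hpriv, hcoh, hint⟩ := exists_corrParams hμ₁ hτ hμ₂ hβ hp₁ hp₂ hk
  have hres0 := resPow_nonneg P₁ hρ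
  have hpriv0 := privPow_nonneg P₂ hρ
  have hint0 := interf_pos P₁ Q hρ
  have hcoh0 : 0 ≤ cohPow P₁ P₂ ρ := sq_nonneg _
  set A := (Q : ℝ) + 2 * c.corr Q + c.corr Q ^ 2 / Q with hA
  have hV : c.varV Q = 1 + A + c.resVar₁ Q := by rw [varV, resVar₁]; ring
  -- Replacing `corr` by `-|corr|` lowers the interference, which weakens the bound by `gain_mono`.
  have hAA : (√(Q : ℝ) + ρ.2.2 * √(P₁ : ℝ)) ^ 2 ≤ A := by
    rw [hint]; linarith [neg_abs_le (c.corr Q)]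
  have hTT : c.resVar₁ Q ≤ resPow P₁ ρ := by rw [hres, resVar₁]; linarith
  have hββ : c.var₂ ≤ privPow P₂ ρ := by linarith
  -- Cauchy–Schwarz lets the conditional means be treated as fully coherent, producing the square in
  -- `cohPow`.
  have hcorr : c.meanCorr Q ≤ √c.meanPow₂ * √(c.meanPow₁ Q) := by
    rw [← Real.sqrt_mul hμ₂, mul_comm]
    exact Real.le_sqrt_of_sq_le c.meanCorr_sq_le
  have hNN : c.meanPow₁ Q + 2 * c.meanCorr Q + c.meanPow₂ + c.var₂
      ≤ privPow P₂ ρ + cohPow P₁ P₂ ρ := by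
    rw [hcoh, add_sq, Real.sq_sqrt hμ₁, Real.sq_sqrt hμ₂]
    linarith
  have hN0 : 0 ≤ c.meanPow₁ Q + 2 * c.meanCorr Q + c.meanPow₂ + c.var₂ := by
    rw [← c.avg_mean₁_add_enc₂_sq h₂]
    exact avg_nonneg fun _ _ => sq_nonneg _
  have hA0 : 0 ≤ A := (sq_nonneg _).trans hAA
  have conv : ∀ {x y r : ℝ}, 0 < x → x ≤ y → n * r * Real.log b ≤ n / 2 * Real.log x →
      r ≤ 1 / 2 * Real.logb b y := by
    intro x y r hx0 hxy h
    have h1 := Real.log_le_log hx0 hxy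
    rw [Real.logb, ← mul_div_assoc, le_div_iff₀ hlogb]
    have h2 : n * (r * Real.log b) ≤ n * (1 / 2 * Real.log x) := by linarith
    linarith [le_of_mul_le_mul_left h2 hn']
  have conv2 : ∀ {N N' r : ℝ}, 0 ≤ N → N ≤ N' →
      n * r * Real.log b
        ≤ n / 2 * Real.log ((c.varV Q + N) * ((1 + c.resVar₁ Q) / c.varV Q)) →
      r ≤ 1 / 2 * Real.logb b (1 + resPow P₁ ρ)
        + 1 / 2 * Real.logb b (1 + N' / interf P₁ Q ρ) := by
    intro N N' r hN hNN h
    have hN' : 0 ≤ N' := hN.trans hNN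
    rw [← mul_add, ← Real.logb_mul (by positivity) (by positivity)]
    rw [hV] at h
    exact conv (by positivity) (gain_mono hN hNN (sq_nonneg _) hAA hT hTT) h
  exact ⟨ρ, hρ, conv (by linarith) (by linarith)
      (hR₂.trans (log_card₂_le_of_state hx hn h₁ h₂)),
    conv2 hβ hββ (hR₂.trans (log_card₂_le hx hn h₁ h₂)),
    conv2 hN0 hNN (hR.trans (log_card_mul_le hx hn h₁ h₂))⟩

end DegradedCode

theorem Achievable.exists_rateBounds {b : ℝ} (hb : 1 < b) {P₁ P₂ Q : ℝ≥0} {R : ℝ × ℝ}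
    (h : Achievable b P₁ P₂ Q R) : ∃ ρ ∈ corrParams, RateBounds b P₁ P₂ Q ρ R := by
  obtain ⟨hR₁, hR₂, K₁, K₂, c, hK₁, hK₂, hP, herr⟩ := h
  have hb0 : 0 < b := by linarith
  have hlogb : 0 < Real.log b := Real.log_pos hb
  have hε : Tendsto (fun n => 1 - (c n).errorProb Q) atTop (𝓝 1) := by
    simpa using herr.const_sub 1
  -- At each positive length the outer bound holds for a perturbed pair. Charging the `log 2` loss
  -- to the second coordinate alone serves both the bounds on `R₂` and the sum bound, where it must
  -- appear only once.
  have hlim : Tendsto (fun n : ℕ => ((1 - (c n).errorProb Q) * R.1,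
      (1 - (c n).errorProb Q) * R.2 - Real.log 2 / Real.log b / n)) atTop (𝓝 R) := by
    have h1 := hε.mul_const R.1
    have h2 := (hε.mul_const R.2).sub
      (tendsto_const_div_atTop_nhds_zero_nat (Real.log 2 / Real.log b))
    simp only [one_mul, sub_zero] at h1 h2
    exact h1.prodMk_nhds h2
  refine (isClosed_setOf_exists_rateBounds b P₁ P₂ Q).mem_of_tendsto hlim ?_
  filter_upwards [eventually_gt_atTop 0] with n hn
  have hn' : (0 : ℝ) < n := by exact_mod_cast hn
  have hk₁ : (0 : ℝ) < K₁ n := (Real.rpow_pos_of_pos hb0 _).trans_le (hK₁ n)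
  have hk₂ : (0 : ℝ) < K₂ n := (Real.rpow_pos_of_pos hb0 _).trans_le (hK₂ n)
  have h₁ : 0 < K₁ n := by exact_mod_cast hk₁
  have h₂ : 0 < K₂ n := by exact_mod_cast hk₂
  have := isProbabilityMeasure_law (n := n) (Q := Q) h₁ h₂
  have he : 0 ≤ 1 - (c n).errorProb Q := sub_nonneg.2 measureReal_le_one
  have l₁ : n * R.1 * Real.log b ≤ Real.log (K₁ n) := by
    rw [← Real.log_rpow hb0]
    exact Real.log_le_log (Real.rpow_pos_of_pos hb0 _) (hK₁ n)
  have l₂ : n * R.2 * Real.log b ≤ Real.log (K₂ n) := by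
    rw [← Real.log_rpow hb0]
    exact Real.log_le_log (Real.rpow_pos_of_pos hb0 _) (hK₂ n)
  have e : n * (Real.log 2 / Real.log b / n) * Real.log b = Real.log 2 := by field_simp
  refine DegradedCode.exists_rateBounds hb hn h₁ h₂ (hP n) ?_ ?_
  · nlinarith [mul_le_mul_of_nonneg_left l₂ he]
  · rw [Real.log_mul hk₁.ne' hk₂.ne']
    nlinarith [mul_le_mul_of_nonneg_left l₂ he, mul_le_mul_of_nonneg_left l₁ he]

end DirtyMAC

end

theorem theorem5 (b : ℝ) (hb : 1 < b) (P₁ P₂ Q : ℝ≥0) (R₁ R₂ : ℝ)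
    (hR : (R₁, R₂) ∈ DirtyMAC.capacityRegionDeg b P₁ P₂ Q) :
    ∃ ρ₁ ∈ Set.Icc (0 : ℝ) 1, ∃ ρ₂ ∈ Set.Icc (0 : ℝ) 1, ∃ ρs ∈ Set.Icc (-1 : ℝ) 0,
      ρ₁ ^ 2 + ρs ^ 2 ≤ 1 ∧
      R₂ ≤ 1 / 2 * Real.logb b (1 + P₂ * (1 - ρ₂ ^ 2)) ∧
      R₂ ≤ 1 / 2 * Real.logb b (1 + P₁ * (1 - ρ₁ ^ 2 - ρs ^ 2))
          + 1 / 2 * Real.logb b (1 + P₂ * (1 - ρ₂ ^ 2)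
            / (1 + (√(Q : ℝ) + ρs * √(P₁ : ℝ)) ^ 2 + P₁ * (1 - ρ₁ ^ 2 - ρs ^ 2))) ∧
      R₁ + R₂ ≤ 1 / 2 * Real.logb b (1 + P₁ * (1 - ρ₁ ^ 2 - ρs ^ 2))
          + 1 / 2 * Real.logb b (1 + (P₂ * (1 - ρ₂ ^ 2) + (ρ₂ * √(P₂ : ℝ) + ρ₁ * √(P₁ : ℝ)) ^ 2)
            / (1 + (√(Q : ℝ) + ρs * √(P₁ : ℝ)) ^ 2 + P₁ * (1 - ρ₁ ^ 2 - ρs ^ 2))) := by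
  obtain ⟨ρ, hρ, h⟩ := closure_minimal
    (fun R hR => DirtyMAC.Achievable.exists_rateBounds hb hR)
    (DirtyMAC.isClosed_setOf_exists_rateBounds b P₁ P₂ Q) hR
  exact ⟨ρ.1, hρ.1.1, ρ.2.1, hρ.1.2.1, ρ.2.2, hρ.1.2.2, hρ.2, h⟩
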